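/- Let $\mathcal{O}=\{(a,b)\in\mathbb{C}^2:\Re(a)<1,\ \Re(b)<1,\ a+b\ne 1,-1,-3,\dots\}$, and let $\Xi:\mathbb{R}\to\mathbb{R}$ be a smooth monotonically decreasing cut-off function with $\Xi(x)=1$ for $x\le\frac13$ and $\Xi(x)=0$ for $x\ge\frac23$. For $t>0$ and integrable $\phi,\rho:[0,1]\to\mathbb{C}$ let $$\beta_{[0,1]}(\phi,\rho,D_{\mathbb{R}})(t)=\int_0^1\int_0^1\frac{1}{\sqrt{4\pi t}}\,e^{-(x-\tilde x)^2/(4t)}\phi(x)\rho(\tilde x)\,dx\,d\tilde x$$ be the heat content of $[0,1]$ in $\mathbb{R}$ for $D_{\mathbb{R}}=-\partial_x^2$. For $(a,b)\in\mathcal{O}$ with $a+b\ne0,-2,-4,\dots$ let $$c(a,b)=2^{-a-b}\frac1{\sqrt\pi}\,\Gamma\Big(\frac{2-a-b}2\Big)\Gamma(a+b-1)\Big(\frac{\Gamma(1-a)}{\Gamma(b)}+\frac{\Gamma(1-b)}{\Gamma(a)}\Big),$$ where $1/\Gamma$ is understood as $0$ at the poles of $\Gamma$, and extend $c$ by continuity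 to the points of $\mathcal{O}$ with $a+b=0,-2,-4,\dots$. Then $c$ is well defined and holomorphic on $\mathcal{O}$, and there exist functions $(a,b)\mapsto c_{a,b,n,\Xi}$ $(n=0,1,2,\dots)$, holomorphic on $\mathcal{O}$, such that for every $(a,b)\in\mathcal{O}$ and every integer $N\ge0$ with $N>\Re(-a-b)+3$, $$\beta_{[0,1]}(\Xi x^{-a},\Xi x^{-b},D_{\mathbb{R}})(t)=\sum_{n=0}^N c_{a,b,n,\Xi}\,t^{n/2}+c(a,b)\,t^{(1-a-b)/2}+O(t^{(N+1)/2})\quad\text{as }t\downarrow0.$$ The constant in the $O$-term may depend on $a,b,N,\Xi$. -/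

import Mathlib

open scoped Topology ContDiff

noncomputable section

namespace HeatContent

/-- The admissible exponents: `Re a < 1`, `Re b < 1` and `a + b ≠ 1, -1, -3, …`. -/
def admissible : Set (ℂ × ℂ) :=
  {p | p.1.re < 1 ∧ p.2.re < 1 ∧ ∀ k : ℕ, p.1 + p.2 ≠ 1 - 2 * (k : ℂ)}

/-- A smooth monotonically decreasing cut-off function which is `1` for `x ≤ 1/3` and `0` for
`x ≥ 2/3`. -/
structure IsCutoff (Ξ : ℝ → ℝ) : Prop where
  smooth : ContDiff ℝ ∞ Ξ
  decreasing : Antitone Ξ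
  eq_one : ∀ x : ℝ, x ≤ 1 / 3 → Ξ x = 1
  eq_zero : ∀ x : ℝ, 2 / 3 ≤ x → Ξ x = 0

/-- The heat kernel of `-∂ₓ²` on the real line. -/
def heatKernel (x y t : ℝ) : ℝ :=
  1 / Real.sqrt (4 * Real.pi * t) * Real.exp (-(x - y) ^ 2 / (4 * t))

/-- The heat content of `Ω ⊆ ℝ` in the real line, for the operator `-∂ₓ²`, with initial
temperature `φ` and specific heat `ρ`. -/
def heatContent (Ω : Set ℝ) (φ ρ : ℝ → ℂ) (t : ℝ) : ℂ :=
  ∫ y in Ω, ∫ x in Ω, (heatKernel x y t : ℂ) * φ x * ρ y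

/-- The function `x ↦ Ξ(x) x^{-a}`. -/
def cutoffPower (Ξ : ℝ → ℝ) (a : ℂ) (x : ℝ) : ℂ :=
  (Ξ x : ℂ) * (x : ℂ) ^ (-a)

/-- The pairs `(a, b)` with `a + b ≠ 0, -2, -4, …`. On the admissible set these are exactly the
points where `Γ(a + b - 1)` has no pole. -/
def regularSet : Set (ℂ × ℂ) :=
  {p | ∀ k : ℕ, p.1 + p.2 ≠ -(2 * (k : ℂ))}

/-- The expression
`2^{-a-b} π^{-1/2} Γ((2-a-b)/2) Γ(a+b-1) (Γ(1-a)/Γ(b) + Γ(1-b)/Γ(a))`.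
Mathlib's `Gamma` is zero at its poles, so the reciprocals `1/Γ(a)` and `1/Γ(b)` have their
usual value zero there; the factor `Γ(a+b-1)` is meaningful on the admissible part of
`regularSet` only. -/
def boundaryFormula (p : ℂ × ℂ) : ℂ :=
  (2 : ℂ) ^ (-p.1 - p.2) * (1 / (Real.sqrt Real.pi : ℂ))
    * Complex.Gamma ((2 - p.1 - p.2) / 2) * Complex.Gamma (p.1 + p.2 - 1)
    * (Complex.Gamma (1 - p.1) / Complex.Gamma p.2
        + Complex.Gamma (1 - p.2) / Complex.Gamma p.1)

/-- The coefficient `c(a, b)`: the extension by continuity of `boundaryFormula` across the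
removable singularities `a + b = 0, -2, -4, …`. -/
def boundaryCoeff : ℂ × ℂ → ℂ :=
  extendFrom regularSet boundaryFormula

end HeatContent

end

noncomputable section

namespace HeatContent

open Filter Set MeasureTheory

/-! Write `t = r^2` and rescale space by `r`. The heat content becomes `r^(1-a-b) * F(r)`, where
`F(r)` pairs `Ξ(rx) x^(-a)` with `Ξ(ry) y^(-b)` on the half line under the heat kernel at time `1`.
The singular powers no longer depend on `r`; only the cut-offs do.

Differentiating `F` in `r` replaces one cut-off by its Euler derivative `xΞ'(x)`, supported in
`[1/3, 2/3]`. That factor times `x^(-a)` is smooth and compactly supported away from the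
singularity, so its heat flow has a Taylor expansion in `r`, with Gaussian moments and derivatives
as coefficients (`exists_variation_expansion`). Integrated against the other factor these
coefficients are entire in `(a, b)`, and odd orders vanish. Integrating in `r` divides order `j` by
`j + a + b - 1`, nonzero on `admissible` for even `j`. This gives the coefficients `c j` and leaves
one constant of integration `L(a, b)` (`exists_content_expansion`), which is the coefficient of
`t^((1-a-b)/2)`.

To identify `L`: if `Re (a + b) > 1`, every power of `r` in the expansion tends to `0`, so `L` is
the limit of `F`, namely the pairing without cut-offs. Splitting the quadrant along the diagonal and
putting `x = vy` turns this into Beta and Gamma integrals (`integral_stripIntegrand`). The remainder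
bounds are locally uniform, so `L` is holomorphic in `b`. Continuation in `b`, the symmetry of `L`,
and a second continuation reach all of `admissible` (`eq_closed`).

Finally, reflection and duplication turn the stated coefficient into `boundaryClosed`, which is
manifestly holomorphic on `admissible`. This settles the removable singularities. -/

/-- The closed form of `boundaryCoeff` on the admissible set. -/
def boundaryClosed (p : ℂ × ℂ) : ℂ :=
  Complex.Gamma (1 - p.1) * Complex.Gamma (1 - p.2) * Complex.Gamma ((p.1 + p.2 - 1) / 2)
    * Complex.cos (Real.pi * (p.1 - p.2) / 2) / (2 * Real.pi)

/-! ### Closed form and holomorphy of the boundary coefficient. -/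

theorem admissible_ne_pole {p : ℂ × ℂ} (hp : p ∈ admissible) (m : ℕ) :
    (p.1 + p.2 - 1) / 2 ≠ -(m : ℂ) := by
  intro h
  apply hp.2.2 m
  linear_combination 2 * h

theorem one_sub_ne_neg_nat {a : ℂ} (ha : a.re < 1) (m : ℕ) : 1 - a ≠ -(m : ℂ) := by
  intro h
  have := congrArg Complex.re h
  simp at this
  have := m.cast_nonneg (α := ℝ)
  linarith

/-- Since `1/Γ` is entire and vanishes exactly at the poles of `Γ`, the infinitely many excluded
lines form the zero set of one continuous function. -/
theorem isOpen_admissible : IsOpen admissible := by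
  have : admissible = {p : ℂ × ℂ | p.1.re < 1} ∩ {p | p.2.re < 1} ∩
      {p | (Complex.Gamma ((p.1 + p.2 - 1) / 2))⁻¹ ≠ 0} := by
    ext p
    simp only [admissible, mem_inter_iff, mem_ofPred_eq, ne_eq, inv_eq_zero,
      Complex.Gamma_eq_zero_iff, not_exists, and_assoc, and_congr_right_iff]
    intro _ _
    refine forall_congr' fun k => not_congr ⟨fun h => ?_, fun h => ?_⟩
    · linear_combination h / 2
    · linear_combination 2 * h
  rw [this]
  refine ((isOpen_lt (by fun_prop) (by fun_prop)).inter
    (isOpen_lt (by fun_prop) (by fun_prop))).inter (isOpen_ne_fun ?_ (by fun_prop))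
  exact Complex.differentiable_one_div_Gamma.continuous.comp
    (by fun_prop : Continuous fun p : ℂ × ℂ => (p.1 + p.2 - 1) / 2)

theorem differentiableAt_boundaryClosed {p : ℂ × ℂ} (hp : p ∈ admissible) :
    DifferentiableAt ℂ boundaryClosed p := by
  have h1 : DifferentiableAt ℂ (fun p : ℂ × ℂ => Complex.Gamma (1 - p.1)) p :=
    (Complex.differentiableAt_Gamma _ (one_sub_ne_neg_nat hp.1)).comp p (by fun_prop)
  have h2 : DifferentiableAt ℂ (fun p : ℂ × ℂ => Complex.Gamma (1 - p.2)) p :=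
    (Complex.differentiableAt_Gamma _ (one_sub_ne_neg_nat hp.2.1)).comp p (by fun_prop)
  have h3 : DifferentiableAt ℂ (fun p : ℂ × ℂ => Complex.Gamma ((p.1 + p.2 - 1) / 2)) p :=
    (Complex.differentiableAt_Gamma _ (admissible_ne_pole hp)).comp p
      (by fun_prop : DifferentiableAt ℂ (fun p : ℂ × ℂ => (p.1 + p.2 - 1) / 2) p)
  have h4 : DifferentiableAt ℂ (fun p : ℂ × ℂ => Complex.cos (Real.pi * (p.1 - p.2) / 2)) p := by
    fun_prop
  have h := (((h1.mul h2).mul h3).mul h4).mul_const (2 * (Real.pi : ℂ))⁻¹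
  exact h.congr_of_eventuallyEq (Eventually.of_forall fun q => by
    simp [boundaryClosed, div_eq_mul_inv])

theorem inv_Gamma_eq {a : ℂ} (ha : a.re < 1) :
    (Complex.Gamma a)⁻¹ = Complex.Gamma (1 - a) * Complex.sin (Real.pi * a) / Real.pi := by
  have h := Complex.Gamma_mul_Gamma_one_sub a
  have hpi : (Real.pi : ℂ) ≠ 0 := by exact_mod_cast Real.pi_ne_zero
  have hg : Complex.Gamma (1 - a) ≠ 0 := Complex.Gamma_ne_zero (one_sub_ne_neg_nat ha)
  -- If the sine vanishes, the reflection formula with division by zero reads `Γ(a) Γ(1-a) = 0`.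
  -- This forces the junk value `Γ(a) = 0`, and both sides are `0`.
  by_cases hs : Complex.sin (Real.pi * a) = 0
  · rw [hs, div_zero] at h
    have : Complex.Gamma a = 0 := by simpa [hg] using h
    simp [this, hs]
  · have h' : Complex.Gamma a * Complex.Gamma (1 - a) * Complex.sin (Real.pi * a) = Real.pi := by
      rw [h]; field_simp
    have : Complex.Gamma a ≠ 0 := by
      intro h0; rw [h0] at h'; simp at h'
      exact hpi h'.symm
    rw [eq_div_iff hpi, inv_mul_eq_iff_eq_mul₀ this]
    linear_combination -h'

/-- Reflection and duplication of the Gamma function combined, away from the poles. -/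
theorem Gamma_mul_Gamma_mul_sin {s : ℂ} (hs : s.re < 2) (hk : ∀ k : ℕ, s ≠ -(2 * (k : ℂ))) :
    Complex.Gamma ((2 - s) / 2) * Complex.Gamma (s - 1) * Complex.sin (Real.pi * s / 2)
        * (2 : ℂ) ^ (-s) = (Real.sqrt Real.pi : ℂ) * Complex.Gamma ((s - 1) / 2) / 4 := by
  have hpi : (Real.pi : ℂ) ≠ 0 := by exact_mod_cast Real.pi_ne_zero
  -- Duplication at `(s-1)/2` relates `Γ(s-1)` to `Γ((s-1)/2) Γ(s/2)`. Reflection at `s/2` then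
  -- removes `Γ(s/2)` against `Γ((2-s)/2)` and the sine.
  have hdup := Complex.Gamma_mul_Gamma_add_half ((s - 1) / 2)
  have href := Complex.Gamma_mul_Gamma_one_sub (s / 2)
  have e1 : (s - 1) / 2 + 1 / 2 = s / 2 := by ring
  have e2 : 2 * ((s - 1) / 2) = s - 1 := by ring
  have e3 : 1 - s / 2 = (2 - s) / 2 := by ring
  have e4 : (Real.pi : ℂ) * (s / 2) = Real.pi * s / 2 := by ring
  rw [e1, e2] at hdup
  rw [e3, e4] at href
  have hG : Complex.Gamma (s / 2) ≠ 0 := by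
    refine Complex.Gamma_ne_zero fun m hm => hk m ?_
    linear_combination 2 * hm
  have hG2 : Complex.Gamma ((2 - s) / 2) ≠ 0 := by
    refine Complex.Gamma_ne_zero fun m hm => ?_
    have := congrArg Complex.re hm
    have e : (2 - s) / 2 = ((1 / 2 : ℝ) : ℂ) * (2 - s) := by push_cast; ring
    rw [e, Complex.re_ofReal_mul] at this
    simp at this
    have := m.cast_nonneg (α := ℝ)
    linarith
  have hsin : Complex.sin (Real.pi * s / 2) ≠ 0 := by
    intro h0
    rw [h0, div_zero] at href
    simp [hG, hG2] at href
  have href' : Complex.Gamma (s / 2) * Complex.Gamma ((2 - s) / 2)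
      * Complex.sin (Real.pi * s / 2) = Real.pi := by
    rw [href]; field_simp
  have hpow : (2 : ℂ) ^ (1 - (s - 1)) = 4 * (2 : ℂ) ^ (-s) := by
    rw [show 1 - (s - 1) = 2 + -s by ring, Complex.cpow_add _ _ two_ne_zero]
    norm_num
  have hsq : (Real.sqrt Real.pi : ℂ) * (Real.sqrt Real.pi : ℂ) = Real.pi := by
    rw [← Complex.ofReal_mul, Real.mul_self_sqrt Real.pi_pos.le]
  rw [hpow] at hdup
  have hsq0 : (Real.sqrt Real.pi : ℂ) ≠ 0 := by
    intro h0; rw [h0] at hsq; simp at hsq; exact hpi hsq.symm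
  have key : Complex.Gamma ((s - 1) / 2) * (Real.sqrt Real.pi : ℂ) = Complex.Gamma (s - 1)
      * (4 * (2 : ℂ) ^ (-s)) * Complex.Gamma ((2 - s) / 2) * Complex.sin (Real.pi * s / 2) := by
    apply mul_right_cancel₀ hsq0
    linear_combination Complex.Gamma ((s - 1) / 2) * hsq - Complex.Gamma ((s - 1) / 2) * href'
      + (Complex.Gamma ((2 - s) / 2) * Complex.sin (Real.pi * s / 2)) * hdup
  linear_combination (-1 / 4) * key

theorem boundaryFormula_eq_closed {p : ℂ × ℂ} (hp : p ∈ admissible) (hr : p ∈ regularSet) :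
    boundaryFormula p = boundaryClosed p := by
  have hpi : (Real.pi : ℂ) ≠ 0 := by exact_mod_cast Real.pi_ne_zero
  have h := Gamma_mul_Gamma_mul_sin (s := p.1 + p.2)
    (by have := hp.1; have := hp.2.1; simp; linarith) hr
  have hsq : (Real.sqrt Real.pi : ℂ) * (Real.sqrt Real.pi : ℂ) = Real.pi := by
    rw [← Complex.ofReal_mul, Real.mul_self_sqrt Real.pi_pos.le]
  have hsq0 : (Real.sqrt Real.pi : ℂ) ≠ 0 := by
    intro h0; rw [h0] at hsq; simp at hsq; exact hpi hsq.symm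
  have hsin : Complex.sin (Real.pi * p.1) + Complex.sin (Real.pi * p.2)
      = 2 * Complex.sin (Real.pi * (p.1 + p.2) / 2) * Complex.cos (Real.pi * (p.1 - p.2) / 2) := by
    have e1 : (Real.pi : ℂ) * p.1
        = Real.pi * (p.1 + p.2) / 2 + Real.pi * (p.1 - p.2) / 2 := by ring
    have e2 : (Real.pi : ℂ) * p.2
        = Real.pi * (p.1 + p.2) / 2 - Real.pi * (p.1 - p.2) / 2 := by ring
    rw [e1, e2, Complex.sin_add, Complex.sin_sub]
    ring
  unfold boundaryFormula boundaryClosed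
  rw [div_eq_mul_inv (Complex.Gamma (1 - p.1)), div_eq_mul_inv (Complex.Gamma (1 - p.2)),
    inv_Gamma_eq hp.1, inv_Gamma_eq hp.2.1]
  rw [show -p.1 - p.2 = -(p.1 + p.2) by ring, show 2 - p.1 - p.2 = 2 - (p.1 + p.2) by ring]
  generalize Complex.Gamma (1 - p.1) = A at *
  generalize Complex.Gamma (1 - p.2) = B at *
  generalize Complex.Gamma ((2 - (p.1 + p.2)) / 2) = X at *
  generalize Complex.Gamma (p.1 + p.2 - 1) = Y at *
  generalize (2 : ℂ) ^ (-(p.1 + p.2)) = Z at *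
  generalize Complex.Gamma ((p.1 + p.2 - 1) / 2) = T at *
  generalize Complex.cos (Real.pi * (p.1 - p.2) / 2) = K at *
  generalize Complex.sin (Real.pi * (p.1 + p.2) / 2) = S at *
  have e : A * (B * Complex.sin (Real.pi * p.2) / Real.pi)
      + B * (A * Complex.sin (Real.pi * p.1) / Real.pi) = A * B * (2 * S * K) / Real.pi := by
    rw [← hsin]; ring
  rw [e]
  field_simp
  linear_combination 4 * A * B * K * h

/-- A small imaginary shift of the first coordinate leaves the real values that `a + b` must avoid.
Density is what makes the value of `extendFrom` determined by a limit. -/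
theorem mem_closure_regularSet (p : ℂ × ℂ) : p ∈ closure regularSet := by
  have hc : Tendsto (fun y : ℝ => ((p.1 + (y : ℂ) * Complex.I, p.2) : ℂ × ℂ))
      (𝓝[>] 0) (𝓝 p) := by
    have : Continuous fun y : ℝ => ((p.1 + (y : ℂ) * Complex.I, p.2) : ℂ × ℂ) := by fun_prop
    have h := (this.tendsto 0).mono_left (nhdsWithin_le_nhds (s := Ioi 0))
    simpa using h
  refine mem_closure_of_frequently_of_tendsto (Eventually.frequently ?_) hc
  have hev : ∀ᶠ y : ℝ in 𝓝[>] 0, y ≠ -(p.1 + p.2).im := by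
    by_cases h : -(p.1 + p.2).im = 0
    · rw [h]
      filter_upwards [self_mem_nhdsWithin] with y hy using hy.ne'
    · exact nhdsWithin_le_nhds (isOpen_ne.mem_nhds (Ne.symm h))
  filter_upwards [hev] with y hy k hk
  apply hy
  have := congrArg Complex.im hk
  simp at this ⊢
  linarith

theorem boundaryCoeff_eq_closed {p : ℂ × ℂ} (hp : p ∈ admissible) :
    boundaryCoeff p = boundaryClosed p := by
  refine extendFrom_eq (mem_closure_regularSet p) ?_
  refine ((differentiableAt_boundaryClosed hp).continuousAt.tendsto.mono_left
    nhdsWithin_le_nhds).congr' ?_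
  filter_upwards [self_mem_nhdsWithin,
    nhdsWithin_le_nhds (isOpen_admissible.mem_nhds hp)] with q hq hq'
  exact (boundaryFormula_eq_closed hq' hq).symm

theorem differentiableOn_boundaryCoeff : DifferentiableOn ℂ boundaryCoeff admissible :=
  DifferentiableOn.congr
    (fun _ hp => (differentiableAt_boundaryClosed hp).differentiableWithinAt)
    fun _ hp => boundaryCoeff_eq_closed hp

theorem boundaryCoeff_eqOn : EqOn boundaryCoeff boundaryFormula (admissible ∩ regularSet) :=
  fun _ hp => (boundaryCoeff_eq_closed hp.1).trans (boundaryFormula_eq_closed hp.1 hp.2).symm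

/-! ### The heat pairing on the half line and its scaling. -/

/-- The heat kernel at time `1`, as a function of the difference. -/
def gauss (w : ℝ) : ℝ := 1 / Real.sqrt (4 * Real.pi) * Real.exp (-w ^ 2 / 4)

theorem gauss_nonneg (w : ℝ) : 0 ≤ gauss w := by unfold gauss; positivity

theorem gauss_neg (w : ℝ) : gauss (-w) = gauss w := by simp [gauss]

theorem gauss_sub_comm (x y : ℝ) : gauss (x - y) = gauss (y - x) := by
  rw [← gauss_neg, neg_sub]

theorem continuous_gauss : Continuous gauss := by unfold gauss; fun_prop

theorem gauss_le_gauss_zero (w : ℝ) : gauss w ≤ gauss 0 := by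
  unfold gauss
  exact mul_le_mul_of_nonneg_left (Real.exp_le_exp.2 (by nlinarith [sq_nonneg w])) (by positivity)

theorem norm_gauss_le (w : ℝ) : ‖(gauss w : ℂ)‖ ≤ gauss 0 := by
  rw [Complex.norm_real, Real.norm_of_nonneg (gauss_nonneg w)]
  exact gauss_le_gauss_zero w

theorem heatKernel_sq {r : ℝ} (hr : 0 < r) (x y : ℝ) :
    heatKernel x y (r ^ 2) = r⁻¹ * gauss ((x - y) / r) := by
  unfold heatKernel gauss
  rw [Real.sqrt_mul (by positivity), Real.sqrt_sq hr.le]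
  rw [show -((x - y) / r) ^ 2 / 4 = -(x - y) ^ 2 / (4 * r ^ 2) by field_simp]
  field_simp

/-- A measurable function bounded by `C` and vanishing beyond `R`. -/
def IsTruncated (f : ℝ → ℂ) (C R : ℝ) : Prop :=
  Measurable f ∧ (∀ x, ‖f x‖ ≤ C) ∧ ∀ x, R < x → f x = 0

theorem IsTruncated.comp_mul {f : ℝ → ℂ} {C R r : ℝ} (hf : IsTruncated f C R) (hr : 0 < r) :
    IsTruncated (fun x => f (r * x)) C (R / r) :=
  ⟨hf.1.comp (by fun_prop), fun x => hf.2.1 _, fun x hx => hf.2.2 _ (by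
    rw [div_lt_iff₀ hr] at hx; linarith)⟩

theorem integrable_indicator_rpow {a : ℝ} (ha : a < 1) (R : ℝ) :
    Integrable ((Iic R).indicator fun x : ℝ => x ^ (-a)) (volume.restrict (Ioi 0)) := by
  rw [integrable_indicator_iff measurableSet_Iic, IntegrableOn,
    Measure.restrict_restrict measurableSet_Iic, Iic_inter_Ioi]
  rcases le_or_gt R 0 with h | h
  · simp [Ioc_eq_empty (not_lt.2 h)]
  · exact (integrableOn_Ioc_iff_integrableOn_Ioo).2
      ((intervalIntegral.integrableOn_Ioo_rpow_iff h).2 (by linarith))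

theorem aestronglyMeasurable_cpow (a : ℂ) :
    AEStronglyMeasurable (fun x : ℝ => (x : ℂ) ^ a) (volume.restrict (Ioi 0)) := by
  refine ContinuousOn.aestronglyMeasurable (fun x hx => ?_) measurableSet_Ioi
  exact (Complex.continuousAt_ofReal_cpow_const _ _ (Or.inr (ne_of_gt hx))).continuousWithinAt

theorem IsTruncated.norm_mul_cpow_le {f : ℝ → ℂ} {C R : ℝ} (hf : IsTruncated f C R) (a : ℂ)
    {x : ℝ} (hx : 0 < x) :
    ‖f x * (x : ℂ) ^ (-a)‖ ≤ C * (Iic R).indicator (fun x : ℝ => x ^ (-a.re)) x := by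
  rw [norm_mul, Complex.norm_cpow_eq_rpow_re_of_pos hx, Complex.neg_re]
  by_cases h : x ≤ R
  · rw [indicator_of_mem (mem_Iic.2 h)]
    gcongr
    exact hf.2.1 x
  · rw [hf.2.2 x (not_le.1 h), indicator_of_notMem (by simpa using h)]
    simp

theorem IsTruncated.aestronglyMeasurable {f : ℝ → ℂ} {C R : ℝ} (hf : IsTruncated f C R) (a : ℂ) :
    AEStronglyMeasurable (fun x => f x * (x : ℂ) ^ (-a)) (volume.restrict (Ioi 0)) :=
  hf.1.aestronglyMeasurable.mul (aestronglyMeasurable_cpow _)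

theorem IsTruncated.integrable {f : ℝ → ℂ} {C R : ℝ} (hf : IsTruncated f C R) {a : ℂ}
    (ha : a.re < 1) :
    Integrable (fun x => f x * (x : ℂ) ^ (-a)) (volume.restrict (Ioi 0)) := by
  refine ((integrable_indicator_rpow ha R).const_mul C).mono' (hf.aestronglyMeasurable a) ?_
  filter_upwards [ae_restrict_mem measurableSet_Ioi] with x hx
  exact hf.norm_mul_cpow_le a hx

/-- Lebesgue measure on the open quadrant. -/
abbrev quadrant : Measure (ℝ × ℝ) :=
  (volume.restrict (Ioi (0 : ℝ))).prod (volume.restrict (Ioi (0 : ℝ)))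

theorem ae_quadrant : ∀ᵐ p ∂quadrant, 0 < p.1 ∧ 0 < p.2 := by
  rw [quadrant, Measure.prod_restrict]
  filter_upwards [ae_restrict_mem (measurableSet_Ioi.prod measurableSet_Ioi)] with p hp
  exact hp

/-- The integrand of `pairing`. -/
def integrand (f g : ℝ → ℂ) (a b : ℂ) (p : ℝ × ℝ) : ℂ :=
  (gauss (p.1 - p.2) : ℂ) * ((f p.1 * (p.1 : ℂ) ^ (-a)) * (g p.2 * (p.2 : ℂ) ^ (-b)))

/-- The heat content of the half line at time `1` for `f x^{-a}` and `g x^{-b}`. -/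
def pairing (f g : ℝ → ℂ) (a b : ℂ) : ℂ := ∫ p, integrand f g a b p ∂quadrant

theorem integrand_swap (f g : ℝ → ℂ) (a b : ℂ) (p : ℝ × ℝ) :
    integrand f g a b p.swap = integrand g f b a p := by
  simp only [integrand, Prod.fst_swap, Prod.snd_swap]
  rw [gauss_sub_comm]
  ring

theorem pairing_swap (f g : ℝ → ℂ) (a b : ℂ) : pairing f g a b = pairing g f b a := by
  unfold pairing
  rw [← integral_prod_swap]
  simp only [integrand_swap]

theorem aestronglyMeasurable_integrand {f g : ℝ → ℂ} {C R C' R' : ℝ} (hf : IsTruncated f C R)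
    (hg : IsTruncated g C' R') (a b : ℂ) :
    AEStronglyMeasurable (integrand f g a b) quadrant := by
  have h1 : AEStronglyMeasurable (fun p : ℝ × ℝ => (gauss (p.1 - p.2) : ℂ)) quadrant := by
    have : Continuous (fun p : ℝ × ℝ => (gauss (p.1 - p.2) : ℂ)) :=
      Complex.continuous_ofReal.comp (continuous_gauss.comp (by fun_prop))
    exact this.aestronglyMeasurable
  exact h1.mul ((hf.aestronglyMeasurable a).comp_fst.mul (hg.aestronglyMeasurable b).comp_snd)

theorem integrable_integrand {f g : ℝ → ℂ} {C R C' R' : ℝ} (hf : IsTruncated f C R)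
    (hg : IsTruncated g C' R') {a b : ℂ} (ha : a.re < 1) (hb : b.re < 1) :
    Integrable (integrand f g a b) quadrant := by
  have h1 : AEStronglyMeasurable (fun p : ℝ × ℝ => (gauss (p.1 - p.2) : ℂ)) quadrant := by
    have : Continuous (fun p : ℝ × ℝ => (gauss (p.1 - p.2) : ℂ)) :=
      Complex.continuous_ofReal.comp (continuous_gauss.comp (by fun_prop))
    exact this.aestronglyMeasurable
  exact ((hf.integrable ha).mul_prod (hg.integrable hb)).bdd_mul h1
    (Eventually.of_forall fun p => norm_gauss_le _)

theorem pairing_eq_integral {f g : ℝ → ℂ} {C R C' R' : ℝ} (hf : IsTruncated f C R)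
    (hg : IsTruncated g C' R') {a b : ℂ} (ha : a.re < 1) (hb : b.re < 1) :
    pairing f g a b = ∫ y in Ioi 0, ∫ x in Ioi 0, integrand f g a b (x, y) :=
  integral_prod_symm _ (integrable_integrand hf hg ha hb)

theorem cpow_eq_mul_cpow {r x : ℝ} (hr : 0 < r) (hx : 0 < x) (a : ℂ) :
    (x : ℂ) ^ (-a) = (r : ℂ) ^ a * ((r * x : ℝ) : ℂ) ^ (-a) := by
  have h0 : (r : ℂ) ≠ 0 := by exact_mod_cast hr.ne'
  rw [Complex.ofReal_mul, Complex.mul_cpow_ofReal_nonneg hr.le hx.le, ← mul_assoc,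
    ← Complex.cpow_add _ _ h0]
  simp

/-- Substitute `x → rx`, `y → ry`: the powers give `r^(a+b)`, passing from `gauss` to the kernel at
time `r^2` gives `r`, and the two differentials give `r^(-2)`. -/
theorem pairing_comp_mul {f g : ℝ → ℂ} {C R C' R' : ℝ} (hf : IsTruncated f C R)
    (hg : IsTruncated g C' R') {a b : ℂ} (ha : a.re < 1) (hb : b.re < 1) {r : ℝ} (hr : 0 < r) :
    pairing (fun x => f (r * x)) (fun x => g (r * x)) a b = (r : ℂ) ^ (a + b - 1) *
      ∫ y in Ioi 0, ∫ x in Ioi 0, (heatKernel x y (r ^ 2) : ℂ) *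
        (f x * (x : ℂ) ^ (-a)) * (g y * (y : ℂ) ^ (-b)) := by
  have h0 : (r : ℂ) ≠ 0 := by exact_mod_cast hr.ne'
  set H : ℝ → ℝ → ℂ := fun x y => (heatKernel x y (r ^ 2) : ℂ) *
        (f x * (x : ℂ) ^ (-a)) * (g y * (y : ℂ) ^ (-b)) with hH
  rw [pairing_eq_integral (hf.comp_mul hr) (hg.comp_mul hr) ha hb]
  have e1 : ∀ y ∈ Ioi (0 : ℝ), ∫ x in Ioi 0,
      integrand (fun x => f (r * x)) (fun x => g (r * x)) a b (x, y)
      = (r : ℂ) ^ (a + b) * ∫ x in Ioi 0, H x (r * y) := by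
    intro y hy
    have e2 : ∫ x in Ioi 0, integrand (fun x => f (r * x)) (fun x => g (r * x)) a b (x, y)
        = ∫ x in Ioi 0, ((r : ℂ) ^ (a + b) * r) * H (r * x) (r * y) := by
      refine setIntegral_congr_fun measurableSet_Ioi fun x hx => ?_
      simp only [integrand, hH]
      rw [cpow_eq_mul_cpow hr hx a, cpow_eq_mul_cpow hr hy b, heatKernel_sq hr,
        Complex.cpow_add _ _ h0, ← mul_sub, mul_div_cancel_left₀ _ hr.ne', Complex.ofReal_mul r⁻¹,
        Complex.ofReal_inv]
      field_simp
    rw [e2, integral_const_mul, integral_comp_mul_left_Ioi (fun x => H x (r * y)) 0 hr, mul_zero,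
      Complex.real_smul, Complex.ofReal_inv]
    field_simp
  rw [setIntegral_congr_fun measurableSet_Ioi e1, integral_const_mul,
    integral_comp_mul_left_Ioi (fun y => ∫ x in Ioi 0, H x y) 0 hr, mul_zero, Complex.real_smul,
    Complex.cpow_sub _ _ h0, Complex.cpow_one, Complex.ofReal_inv, ← mul_assoc, div_eq_mul_inv]

/-! ### Holomorphy through Mellin transforms. -/

theorem locallyIntegrableOn_of_bounded {F : ℝ → ℂ} {C : ℝ}
    (hF : AEStronglyMeasurable F (volume.restrict (Ioi 0))) (hC : ∀ x, ‖F x‖ ≤ C) :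
    LocallyIntegrableOn F (Ioi 0) :=
  locallyIntegrableOn_of_locallyIntegrable_restrict <|
    LocallyIntegrable.mono (f := fun _ : ℝ => C) (Continuous.locallyIntegrable continuous_const) hF
      (Eventually.of_forall fun x => (hC x).trans (le_abs_self C))

theorem differentiableAt_mellin_of_isTruncated {F : ℝ → ℂ} {C R : ℝ}
    (hF : AEStronglyMeasurable F (volume.restrict (Ioi 0)))
    (hC : ∀ x, ‖F x‖ ≤ C) (hR : ∀ x, R < x → F x = 0) {s : ℂ} (hs : 0 < s.re) :
    DifferentiableAt ℂ (mellin F) s := by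
  refine mellin_differentiableAt_of_isBigO_rpow (a := s.re + 1) (b := 0) ?_ ?_ (by linarith) ?_ hs
  · exact locallyIntegrableOn_of_bounded hF hC
  · refine (Asymptotics.isBigO_zero _ _).congr' ?_ EventuallyEq.rfl
    filter_upwards [eventually_gt_atTop R] with x hx
    exact (hR x hx).symm
  · refine Asymptotics.IsBigO.of_bound C (Eventually.of_forall fun x => ?_)
    simpa using hC x

theorem mellinConvergent_of_support {F : ℝ → ℂ} {C δ R : ℝ} (hδ : 0 < δ)
    (hF : AEStronglyMeasurable F (volume.restrict (Ioi 0)))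
    (hC : ∀ x, ‖F x‖ ≤ C) (hR : ∀ x, R < x → F x = 0) (h0 : ∀ x, x < δ → F x = 0) (s : ℂ) :
    MellinConvergent F s := by
  refine mellinConvergent_of_isBigO_rpow (a := s.re + 1) (b := s.re - 1)
    (locallyIntegrableOn_of_bounded hF hC) ?_ (by linarith) ?_ (by linarith)
  · refine (Asymptotics.isBigO_zero _ _).congr' ?_ EventuallyEq.rfl
    filter_upwards [eventually_gt_atTop R] with x hx
    exact (hR x hx).symm
  · refine (Asymptotics.isBigO_zero _ _).congr' ?_ EventuallyEq.rfl
    filter_upwards [nhdsWithin_le_nhds (Iio_mem_nhds hδ)] with x hx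
    exact (h0 x hx).symm

theorem differentiable_mellin_of_support {F : ℝ → ℂ} {C δ R : ℝ} (hδ : 0 < δ)
    (hF : AEStronglyMeasurable F (volume.restrict (Ioi 0)))
    (hC : ∀ x, ‖F x‖ ≤ C) (hR : ∀ x, R < x → F x = 0) (h0 : ∀ x, x < δ → F x = 0) :
    Differentiable ℂ (mellin F) := by
  intro s
  refine mellin_differentiableAt_of_isBigO_rpow (a := s.re + 1) (b := s.re - 1) ?_ ?_
    (by linarith) ?_ (by linarith)
  · exact locallyIntegrableOn_of_bounded hF hC
  · refine (Asymptotics.isBigO_zero _ _).congr' ?_ EventuallyEq.rfl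
    filter_upwards [eventually_gt_atTop R] with x hx
    exact (hR x hx).symm
  · refine (Asymptotics.isBigO_zero _ _).congr' ?_ EventuallyEq.rfl
    filter_upwards [nhdsWithin_le_nhds (Iio_mem_nhds hδ)] with x hx
    exact (h0 x hx).symm

/-- For fixed `a`, integrating out `x` leaves a bounded function `u` of `y`, and the pairing is the
Mellin transform of `g * u` at `1 - b`. -/
theorem pairing_differentiableAt {f g : ℝ → ℂ} {C R C' R' : ℝ} (hf : IsTruncated f C R)
    (hg : IsTruncated g C' R') {a : ℂ} (ha : a.re < 1) {b : ℂ} (hb : b.re < 1) :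
    DifferentiableAt ℂ (fun b => pairing f g a b) b := by
  set u : ℝ → ℂ := fun y => ∫ x in Ioi 0, (gauss (x - y) : ℂ) * (f x * (x : ℂ) ^ (-a)) with hu
  have hum : AEStronglyMeasurable u (volume.restrict (Ioi 0)) := by
    have h1 : AEStronglyMeasurable (fun p : ℝ × ℝ => (gauss (p.2 - p.1) : ℂ)) quadrant := by
      have : Continuous (fun p : ℝ × ℝ => (gauss (p.2 - p.1) : ℂ)) :=
        Complex.continuous_ofReal.comp (continuous_gauss.comp (by fun_prop))
      exact this.aestronglyMeasurable
    exact (h1.mul (hf.aestronglyMeasurable a).comp_snd).integral_prod_right'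
  have hub : ∀ y, ‖u y‖ ≤ ∫ x in Ioi 0, gauss 0 * ‖f x * (x : ℂ) ^ (-a)‖ := by
    intro y
    refine norm_integral_le_of_norm_le ((hf.integrable ha).norm.const_mul _)
      (Eventually.of_forall fun x => ?_)
    rw [norm_mul]
    gcongr
    exact norm_gauss_le _
  have key : ∀ᶠ z in 𝓝 b, pairing f g a z = mellin (fun y => g y * u y) (1 - z) := by
    have : {z : ℂ | z.re < 1} ∈ 𝓝 b :=
      (isOpen_lt Complex.continuous_re continuous_const).mem_nhds hb
    filter_upwards [this] with z hz
    rw [pairing_eq_integral hf hg ha hz, mellin]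
    refine integral_congr_ae (Eventually.of_forall fun y => ?_)
    simp only [integrand, hu, smul_eq_mul]
    rw [← integral_const_mul, ← integral_const_mul]
    refine integral_congr_ae (Eventually.of_forall fun x => ?_)
    simp only
    rw [show (1 - z - 1) = -z by ring]
    ring
  refine DifferentiableAt.congr_of_eventuallyEq ?_ key
  have hm := differentiableAt_mellin_of_isTruncated (F := fun y => g y * u y)
    (C := C' * ∫ x in Ioi 0, gauss 0 * ‖f x * (x : ℂ) ^ (-a)‖) (R := R')
    (hg.1.aestronglyMeasurable.mul hum)
    (fun x => by
      rw [norm_mul]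
      exact mul_le_mul (hg.2.1 x) (hub x) (norm_nonneg _) ((norm_nonneg _).trans (hg.2.1 0)))
    (fun x hx => by rw [hg.2.2 x hx, zero_mul]) (s := 1 - b) (by simpa using hb)
  exact hm.comp b (by fun_prop : DifferentiableAt ℂ (fun z : ℂ => 1 - z) b)

theorem IsTruncated.mono {f : ℝ → ℂ} {C R C' R' : ℝ} (hf : IsTruncated f C R) (hC : C ≤ C')
    (hR : R ≤ R') : IsTruncated f C' R' :=
  ⟨hf.1, fun x => (hf.2.1 x).trans hC, fun x hx => hf.2.2 x (hR.trans_lt hx)⟩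

theorem norm_integrand_le {f g : ℝ → ℂ} {C R C' R' : ℝ} (hf : IsTruncated f C R)
    (hg : IsTruncated g C' R') (a b : ℂ) {p : ℝ × ℝ} (hp : 0 < p.1 ∧ 0 < p.2) :
    ‖integrand f g a b p‖ ≤ gauss 0 * (C * (Iic R).indicator (fun x : ℝ => x ^ (-a.re)) p.1 *
      (C' * (Iic R').indicator (fun x : ℝ => x ^ (-b.re)) p.2)) := by
  have h1 := hf.norm_mul_cpow_le a hp.1
  have h2 := hg.norm_mul_cpow_le b hp.2
  have h3 := gauss_nonneg 0
  have h4 := norm_nonneg (f p.1 * (p.1 : ℂ) ^ (-a))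
  unfold integrand
  rw [norm_mul, norm_mul]
  gcongr
  · exact norm_gauss_le _
  · exact h4.trans h1

/-! ### Cut-off functions and the derivative in the dilation parameter. -/

/-- A cut-off function, with complex values. -/
def cut (Ξ : ℝ → ℝ) (x : ℝ) : ℂ := (Ξ x : ℂ)

/-- The Euler derivative `x Ξ'(x)` of a cut-off function. -/
def eulerCut (Ξ : ℝ → ℝ) (x : ℝ) : ℂ := ((x * deriv Ξ x : ℝ) : ℂ)

section

variable {Ξ : ℝ → ℝ}

theorem IsCutoff.isTruncated (h : IsCutoff Ξ) : IsTruncated (cut Ξ) 1 (2 / 3) := by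
  refine ⟨?_, fun x => ?_, fun x hx => ?_⟩
  · exact (Complex.continuous_ofReal.comp h.smooth.continuous).measurable
  -- Monotonicity confines `Ξ` between its terminal values `0` and `1`.
  · have h0 : 0 ≤ Ξ x := (h.eq_zero _ (le_max_right x _)).symm.le.trans
      (h.decreasing (le_max_left x (2 / 3)))
    have h1 : Ξ x ≤ 1 := (h.decreasing (min_le_left x (1 / 3))).trans
      (h.eq_one _ (min_le_right x _)).le
    rw [cut, Complex.norm_real, Real.norm_of_nonneg h0]
    exact h1
  · simp [cut, h.eq_zero x hx.le]

theorem IsCutoff.contDiff_eulerCut (h : IsCutoff Ξ) : ContDiff ℝ ∞ (eulerCut Ξ) := by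
  have h1 : ContDiff ℝ ∞ (deriv Ξ) := (contDiff_infty_iff_deriv.1 h.smooth).2
  exact Complex.ofRealCLM.contDiff.comp (contDiff_id.mul h1)

theorem IsCutoff.eulerCut_eq_zero (h : IsCutoff Ξ) {x : ℝ} (hx : x ∉ Icc (1 / 3 : ℝ) (2 / 3)) :
    eulerCut Ξ x = 0 := by
  have hd : deriv Ξ x = 0 := by
    rw [mem_Icc, not_and_or, not_le, not_le] at hx
    rcases hx with hx | hx
    · have : Ξ =ᶠ[𝓝 x] fun _ => 1 := by
        filter_upwards [Iio_mem_nhds hx] with y hy using h.eq_one y hy.le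
      rw [this.deriv_eq, deriv_const]
    · have : Ξ =ᶠ[𝓝 x] fun _ => 0 := by
        filter_upwards [Ioi_mem_nhds hx] with y hy using h.eq_zero y hy.le
      rw [this.deriv_eq, deriv_const]
  simp [eulerCut, hd]

theorem exists_bound_of_support {θ : ℝ → ℂ} (h : Continuous θ)
    (h0 : ∀ x, x ∉ Icc (1 / 3 : ℝ) (2 / 3) → θ x = 0) : ∃ C, 0 ≤ C ∧ ∀ x, ‖θ x‖ ≤ C := by
  obtain ⟨C, hC⟩ := h.bounded_above_of_compact_support (HasCompactSupport.intro isCompact_Icc h0)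
  exact ⟨C, (norm_nonneg _).trans (hC 0), hC⟩

theorem isTruncated_of_support {θ : ℝ → ℂ} (h : Continuous θ)
    (h0 : ∀ x, x ∉ Icc (1 / 3 : ℝ) (2 / 3) → θ x = 0) : ∃ C, 0 ≤ C ∧ IsTruncated θ C (2 / 3) := by
  obtain ⟨C, hC0, hC⟩ := exists_bound_of_support h h0
  exact ⟨C, hC0, h.measurable, hC, fun x hx => h0 x fun hx' => hx.not_ge hx'.2⟩

theorem IsCutoff.hasDerivAt_cut (h : IsCutoff Ξ) {r x : ℝ} (hr : r ≠ 0) :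
    HasDerivAt (fun r => cut Ξ (r * x)) ((r : ℂ)⁻¹ * eulerCut Ξ (r * x)) r := by
  have h1 : HasDerivAt Ξ (deriv Ξ (r * x)) (r * x) :=
    (h.smooth.differentiable (by simp)).differentiableAt.hasDerivAt
  have h2 : HasDerivAt (fun r => Ξ (r * x)) (deriv Ξ (r * x) * x) r := by
    have := h1.comp r ((hasDerivAt_id r).mul_const x)
    simpa [Function.comp_def] using this
  have h3 : HasDerivAt (fun r => cut Ξ (r * x)) ((deriv Ξ (r * x) * x : ℝ) : ℂ) r :=
    h2.ofReal_comp
  convert h3 using 1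
  simp only [eulerCut]
  push_cast
  have : (r : ℂ) ≠ 0 := by exact_mod_cast hr
  field_simp

/-- The heat content of the half line for rescaled cut-off functions. -/
def scaledContent (Ξ : ℝ → ℝ) (a b : ℂ) (r : ℝ) : ℂ :=
  pairing (fun x => cut Ξ (r * x)) (fun x => cut Ξ (r * x)) a b

/-- The variation of `scaledContent` with respect to the first cut-off function. -/
def scaledVariation (Ξ : ℝ → ℝ) (a b : ℂ) (r : ℝ) : ℂ :=
  pairing (fun x => eulerCut Ξ (r * x)) (fun x => cut Ξ (r * x)) a b

theorem scaledContent_swap (a b : ℂ) (r : ℝ) :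
    scaledContent Ξ a b r = scaledContent Ξ b a r := pairing_swap _ _ _ _

theorem IsCutoff.hasDerivAt_scaledContent (h : IsCutoff Ξ) {a b : ℂ} (ha : a.re < 1)
    (hb : b.re < 1) {r₀ : ℝ} (hr₀ : 0 < r₀) :
    HasDerivAt (scaledContent Ξ a b)
      ((r₀ : ℂ)⁻¹ * (scaledVariation Ξ a b r₀ + scaledVariation Ξ b a r₀)) r₀ := by
  obtain ⟨B, hB0, hB⟩ := isTruncated_of_support h.contDiff_eulerCut.continuous
    fun x => h.eulerCut_eq_zero
  have hcut := h.isTruncated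
  -- For `r > r₀/2` all rescaled cut-offs vanish beyond the same `R`, so a single integrable
  -- function dominates the derivatives.
  set R : ℝ := 2 / 3 / (r₀ / 2) with hR
  have hle : ∀ r ∈ Ioi (r₀ / 2), 2 / 3 / r ≤ R := fun r hr =>
    div_le_div_of_nonneg_left (by norm_num) (by positivity) (le_of_lt hr)
  have hpos : ∀ r ∈ Ioi (r₀ / 2), 0 < r := fun r hr => lt_trans (by positivity) hr
  have hmem : r₀ ∈ Ioi (r₀ / 2) := by simp only [mem_Ioi]; linarith
  have hc : ∀ r ∈ Ioi (r₀ / 2), IsTruncated (fun x => cut Ξ (r * x)) 1 R := fun r hr =>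
    (hcut.comp_mul (hpos r hr)).mono le_rfl (hle r hr)
  have he : ∀ r ∈ Ioi (r₀ / 2), IsTruncated (fun x => eulerCut Ξ (r * x)) B R := fun r hr =>
    (hB.comp_mul (hpos r hr)).mono le_rfl (hle r hr)
  set F' : ℝ → ℝ × ℝ → ℂ := fun r p => (r : ℂ)⁻¹ *
    (integrand (fun x => eulerCut Ξ (r * x)) (fun x => cut Ξ (r * x)) a b p +
      integrand (fun x => cut Ξ (r * x)) (fun x => eulerCut Ξ (r * x)) a b p) with hF'
  set u : ℝ × ℝ → ℝ := fun p => (Iic R).indicator (fun x : ℝ => x ^ (-a.re)) p.1 *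
      (Iic R).indicator (fun x : ℝ => x ^ (-b.re)) p.2 with hu
  have hui : Integrable u quadrant :=
    (integrable_indicator_rpow ha R).mul_prod (integrable_indicator_rpow hb R)
  have key := (hasDerivAt_integral_of_dominated_loc_of_deriv_le (μ := quadrant)
    (F := fun r p => integrand (fun x => cut Ξ (r * x)) (fun x => cut Ξ (r * x)) a b p)
    (F' := F') (x₀ := r₀) (s := Ioi (r₀ / 2))
    (bound := fun p => ((r₀ / 2)⁻¹ * (2 * gauss 0 * B)) * u p)
    (Ioi_mem_nhds hmem) ?_ ?_ ?_ ?_ ?_ ?_).2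
  · refine HasDerivAt.congr_deriv key ?_
    have i1 := integrable_integrand (he r₀ hmem) (hc r₀ hmem) ha hb
    have i2 := integrable_integrand (hc r₀ hmem) (he r₀ hmem) ha hb
    simp only [hF']
    rw [integral_const_mul, integral_add i1 i2]
    unfold scaledVariation
    rw [pairing_swap _ _ b a]
    rfl
  · filter_upwards [Ioi_mem_nhds hmem] with r hr
    exact aestronglyMeasurable_integrand (hc r hr) (hc r hr) a b
  · exact integrable_integrand (hc r₀ hmem) (hc r₀ hmem) ha hb
  · exact ((aestronglyMeasurable_integrand (he r₀ hmem) (hc r₀ hmem) a b).add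
      (aestronglyMeasurable_integrand (hc r₀ hmem) (he r₀ hmem) a b)).const_mul _
  · filter_upwards [ae_quadrant] with p hp r hr
    have n1 := norm_integrand_le (he r hr) (hc r hr) a b hp
    have n2 := norm_integrand_le (hc r hr) (he r hr) a b hp
    have n3 : ‖(r : ℂ)⁻¹‖ ≤ (r₀ / 2)⁻¹ := by
      rw [norm_inv, Complex.norm_real, Real.norm_of_nonneg (hpos r hr).le]
      exact inv_anti₀ (by positivity) (le_of_lt hr)
    rw [hF', norm_mul, mul_assoc]
    refine mul_le_mul n3 ((norm_add_le _ _).trans ((add_le_add n1 n2).trans (le_of_eq ?_)))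
      (norm_nonneg _) (by positivity)
    simp only [hu]
    ring
  · exact hui.const_mul _
  · refine Eventually.of_forall fun p r hr => ?_
    have d1 := h.hasDerivAt_cut (x := p.1) (hpos r hr).ne'
    have d2 := h.hasDerivAt_cut (x := p.2) (hpos r hr).ne'
    have := (((d1.mul_const ((p.1 : ℂ) ^ (-a))).mul (d2.mul_const ((p.2 : ℂ) ^ (-b)))).const_mul
      (gauss (p.1 - p.2) : ℂ))
    refine HasDerivAt.congr_deriv this ?_
    simp only [hF', integrand]
    ring

end

/-! ### Amplitudes: derivatives of `θ(x) x^(-a)`, tracked polynomially in `a`. -/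

/-- Polynomials in a parameter `a` whose coefficients are smooth functions supported in
`[1/3, 2/3]`. -/
inductive IsAmplitude : (ℂ → ℝ → ℂ) → Prop
  | of (θ : ℝ → ℂ) (hθ : ContDiff ℝ ∞ θ) (h0 : ∀ x, x ∉ Icc (1 / 3 : ℝ) (2 / 3) → θ x = 0) :
      IsAmplitude fun _ x => θ x
  | add {p q : ℂ → ℝ → ℂ} (hp : IsAmplitude p) (hq : IsAmplitude q) :
      IsAmplitude fun a x => p a x + q a x
  | param_mul {p : ℂ → ℝ → ℂ} (hp : IsAmplitude p) : IsAmplitude fun a x => a * p a x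

theorem IsAmplitude.continuous {p : ℂ → ℝ → ℂ} (hp : IsAmplitude p) (a : ℂ) :
    Continuous (p a) := by
  induction hp with
  | of θ hθ h0 => exact hθ.continuous
  | add _ _ hp hq => exact hp.add hq
  | param_mul _ hp => exact continuous_const.mul hp

theorem IsAmplitude.eq_zero {p : ℂ → ℝ → ℂ} (hp : IsAmplitude p) (a : ℂ) {x : ℝ}
    (hx : x ∉ Icc (1 / 3 : ℝ) (2 / 3)) : p a x = 0 := by
  induction hp with
  | of θ hθ h0 => exact h0 x hx
  | add _ _ hp hq => simp only [hp, hq, add_zero]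
  | param_mul _ hp => simp only [hp, mul_zero]

theorem IsAmplitude.exists_bound {p : ℂ → ℝ → ℂ} (hp : IsAmplitude p) :
    ∃ S : ℂ → ℝ, Continuous S ∧ ∀ a x, ‖p a x‖ ≤ S a := by
  induction hp with
  | of θ hθ h0 =>
    obtain ⟨C, -, hC⟩ := exists_bound_of_support hθ.continuous h0
    exact ⟨fun _ => C, continuous_const, fun _ => hC⟩
  | add _ _ hp hq =>
    obtain ⟨S, hS, h⟩ := hp
    obtain ⟨T, hT, h'⟩ := hq
    exact ⟨fun a => S a + T a, hS.add hT,
      fun a x => (norm_add_le _ _).trans (add_le_add (h a x) (h' a x))⟩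
  | param_mul _ hp =>
    obtain ⟨S, hS, h⟩ := hp
    refine ⟨fun a => ‖a‖ * S a, continuous_norm.mul hS, fun a x => ?_⟩
    rw [norm_mul]
    exact mul_le_mul_of_nonneg_left (h a x) (norm_nonneg _)

/-- The numerator vanishes near the origin, so dividing by `x` creates no singularity. -/
theorem contDiff_div_id {θ : ℝ → ℂ} (hθ : ContDiff ℝ ∞ θ)
    (h0 : ∀ x, x ∉ Icc (1 / 3 : ℝ) (2 / 3) → θ x = 0) : ContDiff ℝ ∞ fun x => θ x / (x : ℂ) := by
  rw [contDiff_iff_contDiffAt]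
  intro x
  rcases eq_or_ne x 0 with rfl | hx
  · have : (fun x : ℝ => θ x / (x : ℂ)) =ᶠ[𝓝 0] fun _ => 0 := by
      filter_upwards [Iio_mem_nhds (show (0 : ℝ) < 1 / 3 by norm_num)] with y hy
      rw [h0 y fun h => (not_le.2 hy) h.1, zero_div]
    exact contDiffAt_const.congr_of_eventuallyEq this
  · simp only [div_eq_mul_inv]
    exact hθ.contDiffAt.mul (Complex.ofRealCLM.contDiff.contDiffAt.inv (by simpa using hx))

theorem hasDerivAt_ofReal_cpow_neg (a : ℂ) {x : ℝ} (hx : 0 < x) :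
    HasDerivAt (fun x : ℝ => (x : ℂ) ^ (-a)) (-a / x * (x : ℂ) ^ (-a)) x := by
  have h0 : (x : ℂ) ≠ 0 := by exact_mod_cast hx.ne'
  have h := ((hasDerivAt_id (x : ℂ)).cpow_const (c := -a)
    (Or.inl (by simpa using hx))).comp_ofReal
  refine HasDerivAt.congr_deriv h ?_
  simp only [id_eq, mul_one]
  rw [Complex.cpow_sub _ _ h0, Complex.cpow_one]
  ring

/-- Since `(θ x^(-a))' = (θ' - a θ/x) x^(-a)`, differentiation keeps the factor `x^(-a)` and only
adds a power of the parameter. This is why the class is closed under multiplication by `a`. -/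
theorem IsAmplitude.exists_deriv {p : ℂ → ℝ → ℂ} (hp : IsAmplitude p) :
    ∃ q, IsAmplitude q ∧ ∀ (a : ℂ) (x : ℝ),
      HasDerivAt (fun x : ℝ => p a x * (x : ℂ) ^ (-a)) (q a x * (x : ℂ) ^ (-a)) x := by
  induction hp with
  | of θ hθ h0 =>
    have hd0 : ∀ x, x ∉ Icc (1 / 3 : ℝ) (2 / 3) → deriv θ x = 0 := by
      intro x hx
      have : θ =ᶠ[𝓝 x] fun _ => 0 := by
        filter_upwards [isClosed_Icc.isOpen_compl.mem_nhds hx] with y hy using h0 y hy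
      rw [this.deriv_eq, deriv_const]
    refine ⟨_, (IsAmplitude.of (deriv θ) (contDiff_infty_iff_deriv.1 hθ).2 hd0).add
      (IsAmplitude.of (fun x => -(θ x / x)) (contDiff_div_id hθ h0).neg
        fun x hx => by simp [h0 x hx]).param_mul, fun a x => ?_⟩
    rcases lt_or_ge 0 x with hx | hx
    · have h1 : HasDerivAt θ (deriv θ x) x :=
        (hθ.differentiable (by simp)).differentiableAt.hasDerivAt
      refine HasDerivAt.congr_deriv (h1.mul (hasDerivAt_ofReal_cpow_neg a hx)) ?_
      ring
    · have hx' : x ∉ Icc (1 / 3 : ℝ) (2 / 3) := fun h => by linarith [h.1]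
      rw [hd0 x hx', h0 x hx']
      have : (fun x : ℝ => θ x * (x : ℂ) ^ (-a)) =ᶠ[𝓝 x] fun _ => 0 := by
        filter_upwards [isClosed_Icc.isOpen_compl.mem_nhds hx'] with y hy
        rw [h0 y hy, zero_mul]
      simpa using (hasDerivAt_const x (0 : ℂ)).congr_of_eventuallyEq this
  | add _ _ hp hq =>
    obtain ⟨p', hp', h⟩ := hp
    obtain ⟨q', hq', h'⟩ := hq
    refine ⟨_, hp'.add hq', fun a x => ?_⟩
    simp only [add_mul]
    exact (h a x).add (h' a x)
  | param_mul _ hp =>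
    obtain ⟨p', hp', h⟩ := hp
    refine ⟨_, hp'.param_mul, fun a x => ?_⟩
    simp only [mul_assoc]
    exact (h a x).const_mul a

theorem IsAmplitude.exists_derivSeq {p : ℂ → ℝ → ℂ} (hp : IsAmplitude p) :
    ∃ P : ℕ → ℂ → ℝ → ℂ, P 0 = p ∧ (∀ j, IsAmplitude (P j)) ∧ ∀ (j : ℕ) (a : ℂ) (x : ℝ),
      HasDerivAt (fun x : ℝ => P j a x * (x : ℂ) ^ (-a)) (P (j + 1) a x * (x : ℂ) ^ (-a)) x := by
  choose D hD hD' using fun q : {q // IsAmplitude q} => q.2.exists_deriv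
  let E : {q // IsAmplitude q} → {q // IsAmplitude q} := fun q => ⟨D q, hD q⟩
  refine ⟨fun j => (E^[j] ⟨p, hp⟩).1, rfl, fun j => (E^[j] ⟨p, hp⟩).2, fun j a x => ?_⟩
  simp only [Function.iterate_succ_apply']
  exact hD' _ a x

theorem IsAmplitude.mul_cut {p : ℂ → ℝ → ℂ} (hp : IsAmplitude p) {Ξ : ℝ → ℝ} (h : IsCutoff Ξ)
    (a : ℂ) : ∃ C, AEStronglyMeasurable (fun x => p a x * cut Ξ x) (volume.restrict (Ioi 0)) ∧
      (∀ x, ‖p a x * cut Ξ x‖ ≤ C) ∧ (∀ x, 2 / 3 < x → p a x * cut Ξ x = 0) ∧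
      ∀ x, x < 1 / 3 → p a x * cut Ξ x = 0 := by
  obtain ⟨S, -, hS⟩ := hp.exists_bound
  have hc := h.isTruncated
  refine ⟨S a * 1, (hp.continuous a).aestronglyMeasurable.mul hc.1.aestronglyMeasurable,
    fun x => ?_, fun x hx => ?_, fun x hx => ?_⟩
  · rw [norm_mul]
    exact mul_le_mul (hS a x) (hc.2.1 x) (norm_nonneg _) ((norm_nonneg _).trans (hS a x))
  · rw [hp.eq_zero a fun h => hx.not_ge h.2, zero_mul]
  · rw [hp.eq_zero a fun h => hx.not_ge h.1, zero_mul]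

theorem IsAmplitude.integrable {p : ℂ → ℝ → ℂ} (hp : IsAmplitude p) {Ξ : ℝ → ℝ} (h : IsCutoff Ξ)
    (a s : ℂ) :
    Integrable (fun x : ℝ => p a x * cut Ξ x * (x : ℂ) ^ (-s)) (volume.restrict (Ioi 0)) := by
  obtain ⟨C, h1, h2, h3, h4⟩ := hp.mul_cut h a
  have := mellinConvergent_of_support (by norm_num) h1 h2 h3 h4 (1 - s)
  rw [MellinConvergent] at this
  refine Integrable.congr this (Eventually.of_forall fun x => ?_)
  simp only [smul_eq_mul]
  rw [show 1 - s - 1 = -s by ring]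
  ring

theorem differentiable_of_eq {f g : ℂ × ℂ → ℂ} (hf : Differentiable ℂ f) (h : ∀ z, f z = g z) :
    Differentiable ℂ g :=
  (funext h : f = g) ▸ hf

/-- Joint holomorphy in both exponents follows the construction of the amplitude: a parameter-free
one gives a Mellin transform at `1 - (a + b)`, while sums and factors `a` pass through the integral.
-/
theorem IsAmplitude.differentiable_integral {p : ℂ → ℝ → ℂ} (hp : IsAmplitude p) {Ξ : ℝ → ℝ}
    (h : IsCutoff Ξ) :
    Differentiable ℂ fun z : ℂ × ℂ =>
      ∫ x in Ioi (0 : ℝ), p z.1 x * cut Ξ x * (x : ℂ) ^ (-(z.1 + z.2)) := by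
  induction hp with
  | of θ hθ h0 =>
    obtain ⟨C, h1, h2, h3, h4⟩ := (IsAmplitude.of θ hθ h0).mul_cut h 0
    have hd := differentiable_mellin_of_support (by norm_num) h1 h2 h3 h4
    refine differentiable_of_eq
      (hd.comp (by fun_prop : Differentiable ℂ fun z : ℂ × ℂ => 1 - (z.1 + z.2))) fun z => ?_
    rw [Function.comp_apply, mellin]
    refine integral_congr_ae (Eventually.of_forall fun x => ?_)
    simp only [smul_eq_mul]
    rw [show 1 - (z.1 + z.2) - 1 = -(z.1 + z.2) by ring]
    ring
  | @add p q hp' hq' hp hq =>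
    refine differentiable_of_eq (hp.add hq) fun z => ?_
    rw [Pi.add_apply, ← integral_add (hp'.integrable h _ _) (hq'.integrable h _ _)]
    simp only [add_mul]
  | @param_mul p hp' hp =>
    refine differentiable_of_eq (differentiable_fst.mul hp) fun z => ?_
    rw [Pi.mul_apply, ← integral_const_mul]
    simp only [mul_assoc]

/-! ### Taylor expansion of the heat flow. -/

theorem norm_taylor_remainder_le {f : ℕ → ℝ → ℂ} (hf : ∀ j x, HasDerivAt (f j) (f (j + 1) x) x)
    {n : ℕ} {S : ℝ} (hS : ∀ x, ‖f n x‖ ≤ S) (y h : ℝ) :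
    ‖f 0 (y + h) - ∑ j ∈ Finset.range n, (h : ℂ) ^ j / (j.factorial : ℂ) * f j y‖
      ≤ S * |h| ^ n := by
  induction n generalizing f h with
  | zero => simpa using hS (y + h)
  | succ n ih =>
    have hS0 : 0 ≤ S := (norm_nonneg _).trans (hS 0)
    set D : ℝ → ℂ := fun z => f 0 (y + z) -
      ∑ j ∈ Finset.range (n + 1), (z : ℂ) ^ j / (j.factorial : ℂ) * f j y with hD
    set D' : ℝ → ℂ := fun z => f 1 (y + z) -
      ∑ j ∈ Finset.range n, (z : ℂ) ^ j / (j.factorial : ℂ) * f (j + 1) y with hD'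
    have hder : ∀ z, HasDerivAt D (D' z) z := by
      intro z
      refine HasDerivAt.sub ((hf 0 (y + z)).comp_const_add y z) ?_
      have : ∑ j ∈ Finset.range n, (z : ℂ) ^ j / (j.factorial : ℂ) * f (j + 1) y
          = ∑ j ∈ Finset.range (n + 1),
            ((j : ℂ) * (z : ℂ) ^ (j - 1)) / (j.factorial : ℂ) * f j y := by
        rw [Finset.sum_range_succ']
        simp only [Nat.cast_zero, zero_mul, zero_div, add_zero, Nat.add_sub_cancel]
        refine Finset.sum_congr rfl fun j _ => ?_
        rw [Nat.factorial_succ]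
        have h1 : ((j + 1 : ℕ) : ℂ) ≠ 0 := by exact_mod_cast j.succ_ne_zero
        have h2 : (j.factorial : ℂ) ≠ 0 := by exact_mod_cast j.factorial_ne_zero
        push_cast at h1 ⊢
        field_simp
      rw [this]
      refine HasDerivAt.fun_sum fun j _ => ?_
      exact (((hasDerivAt_pow j (z : ℂ)).comp_ofReal).div_const _).mul_const _
    -- The ball handles both signs of `h`. The mean value inequality then contributes one factor
    -- `|h|`; the gain of `1/n!` is not needed.
    have hb : ∀ z ∈ Metric.closedBall (0 : ℝ) |h|, ‖D' z‖ ≤ S * |h| ^ n := by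
      intro z hz
      refine (ih (f := fun j => f (j + 1)) (fun j x => hf (j + 1) x) hS z).trans ?_
      have : |z| ≤ |h| := by simpa using hz
      gcongr
    have := Convex.norm_image_sub_le_of_norm_hasDerivWithin_le (x := 0) (y := h)
      (fun z _ => (hder z).hasDerivWithinAt) hb (convex_closedBall _ _)
      (by simp) (by simp)
    have h0 : D 0 = 0 := by
      simp [hD, Finset.sum_range_succ']
    rw [h0, sub_zero, sub_zero, Real.norm_eq_abs] at this
    rw [pow_succ, ← mul_assoc]
    exact this

/-- The moments of the heat kernel at time `1`. -/
def gaussMoment (j : ℕ) : ℂ := ∫ w : ℝ, (gauss w : ℂ) * (w : ℂ) ^ j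

/-- The absolute moments of the heat kernel at time `1`. -/
def gaussAbsMoment (j : ℕ) : ℝ := ∫ w : ℝ, gauss w * |w| ^ j

theorem integrable_gauss_mul_pow (j : ℕ) :
    Integrable fun w : ℝ => (gauss w : ℂ) * (w : ℂ) ^ j := by
  have h := (integrable_rpow_mul_exp_neg_mul_sq (b := 1 / 4) (by norm_num) (s := j)
    (by have := j.cast_nonneg (α := ℝ); linarith)).const_mul (1 / Real.sqrt (4 * Real.pi))
  refine (h.ofReal (𝕜 := ℂ)).congr (Eventually.of_forall fun w => ?_)
  have e : 1 / Real.sqrt (4 * Real.pi) * (w ^ (j : ℝ) * Real.exp (-(1 / 4) * w ^ 2))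
      = gauss w * w ^ j := by
    rw [gauss, Real.rpow_natCast, show -(1 / 4 : ℝ) * w ^ 2 = -w ^ 2 / 4 by ring]
    ring
  exact (congrArg Complex.ofReal e).trans (by push_cast; rfl)

theorem integrable_gauss_mul_abs_pow (j : ℕ) :
    Integrable fun w : ℝ => gauss w * |w| ^ j := by
  refine (integrable_gauss_mul_pow j).norm.congr (Eventually.of_forall fun w => ?_)
  simp only
  rw [norm_mul, norm_pow, Complex.norm_real, Complex.norm_real,
    Real.norm_of_nonneg (gauss_nonneg w), Real.norm_eq_abs]

/-- The Gaussian is even. The vanishing removes the odd orders, whose denominators `j + a + b - 1`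
may be zero on `admissible`. -/
theorem gaussMoment_odd {j : ℕ} (hj : Odd j) : gaussMoment j = 0 := by
  have h : gaussMoment j = -gaussMoment j := by
    unfold gaussMoment
    rw [← integral_neg, ← integral_neg_eq_self]
    refine integral_congr_ae (Eventually.of_forall fun w => ?_)
    simp only [gauss_neg, Complex.ofReal_neg, hj.neg_pow]
    ring
  linear_combination h / 2

theorem IsAmplitude.exists_bound_mul_cpow {p : ℂ → ℝ → ℂ} (hp : IsAmplitude p) :
    ∃ S : ℂ → ℝ, Continuous S ∧ ∀ (a : ℂ) (x : ℝ), ‖p a x * (x : ℂ) ^ (-a)‖ ≤ S a := by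
  obtain ⟨S, hS, hb⟩ := hp.exists_bound
  have hS0 : ∀ a, 0 ≤ S a := fun a => (norm_nonneg _).trans (hb a 0)
  -- On `[1/3, 2/3]` the power `x^(-Re a)` is monotone, so it is at most its value at one endpoint;
  -- the sum covers both signs of the exponent and stays continuous in `a`.
  refine ⟨fun a => S a * ((1 / 3 : ℝ) ^ (-a.re) + (2 / 3 : ℝ) ^ (-a.re)), ?_, fun a x => ?_⟩
  · refine hS.mul (((Real.continuous_const_rpow (by norm_num)).comp
      Complex.continuous_re.neg).add ((Real.continuous_const_rpow (by norm_num)).comp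
      Complex.continuous_re.neg))
  · by_cases hx : x ∈ Icc (1 / 3 : ℝ) (2 / 3)
    · have hx0 : 0 < x := lt_of_lt_of_le (by norm_num) hx.1
      rw [norm_mul, Complex.norm_cpow_eq_rpow_re_of_pos hx0, Complex.neg_re]
      refine mul_le_mul (hb a x) ?_ (by positivity) (hS0 a)
      rcases le_total 0 (-a.re) with h | h
      · have := Real.rpow_le_rpow hx0.le hx.2 h
        have h2 : (0 : ℝ) ≤ (1 / 3 : ℝ) ^ (-a.re) := by positivity
        linarith
      · have := Real.rpow_le_rpow_of_nonpos (by norm_num) hx.1 h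
        have h2 : (0 : ℝ) ≤ (2 / 3 : ℝ) ^ (-a.re) := by positivity
        linarith
    · rw [hp.eq_zero a hx, zero_mul, norm_zero]
      exact mul_nonneg (hS0 a) (by positivity)

/-- Heat flow of a function supported away from zero, as a Gaussian average. -/
theorem integral_heatKernel_eq {ψ : ℝ → ℂ} (h0 : ∀ x, x ≤ 0 → ψ x = 0) {r : ℝ} (hr : 0 < r)
    (y : ℝ) : ∫ x in Ioi 0, (heatKernel x y (r ^ 2) : ℂ) * ψ x
      = ∫ w : ℝ, (gauss w : ℂ) * ψ (y + r * w) := by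
  rw [setIntegral_eq_integral_of_forall_compl_eq_zero fun x hx => by
    rw [h0 x (not_lt.1 hx), mul_zero]]
  have h1 := Measure.integral_comp_mul_left (fun z => (gauss (z / r) : ℂ) * ψ (y + z)) r
  have h2 := integral_sub_right_eq_self (fun z => (gauss (z / r) : ℂ) * ψ (y + z)) y (μ := volume)
  simp only [mul_div_cancel_left₀ _ hr.ne'] at h1
  rw [h1, ← h2, abs_of_pos (inv_pos.2 hr), Complex.real_smul, ← integral_const_mul]
  refine integral_congr_ae (Eventually.of_forall fun x => ?_)
  simp only [heatKernel_sq hr, add_sub_cancel]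
  push_cast
  ring

/-- Taylor expansion of a Gaussian average. -/
theorem norm_gauss_average_sub_le {f : ℕ → ℝ → ℂ}
    (hf : ∀ j x, HasDerivAt (f j) (f (j + 1) x) x) {n : ℕ} {S S₀ : ℝ} (hS : ∀ x, ‖f n x‖ ≤ S)
    (hS₀ : ∀ x, ‖f 0 x‖ ≤ S₀) {r : ℝ} (hr : 0 < r) (y : ℝ) :
    ‖(∫ w : ℝ, (gauss w : ℂ) * f 0 (y + r * w)) -
      ∑ j ∈ Finset.range n, gaussMoment j / (j.factorial : ℂ) * (r : ℂ) ^ j * f j y‖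
      ≤ S * gaussAbsMoment n * r ^ n := by
  have hc : Continuous (f 0) := continuous_iff_continuousAt.2 fun x => (hf 0 x).continuousAt
  have i0 : Integrable fun w : ℝ => (gauss w : ℂ) * f 0 (y + r * w) := by
    have h := integrable_gauss_mul_pow 0
    simp only [pow_zero, mul_one] at h
    refine h.mul_bdd (c := S₀) (hc.comp (by fun_prop)).aestronglyMeasurable
      (Eventually.of_forall fun w => hS₀ _)
  have i1 : ∀ j, Integrable fun w : ℝ =>
      (gauss w : ℂ) * (((r * w : ℝ) : ℂ) ^ j / (j.factorial : ℂ) * f j y) := by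
    intro j
    refine ((integrable_gauss_mul_pow j).mul_const
      ((r : ℂ) ^ j / (j.factorial : ℂ) * f j y)).congr (Eventually.of_forall fun w => ?_)
    simp only
    push_cast
    ring
  have e1 : ∀ j, gaussMoment j / (j.factorial : ℂ) * (r : ℂ) ^ j * f j y
      = ∫ w : ℝ, (gauss w : ℂ) * (((r * w : ℝ) : ℂ) ^ j / (j.factorial : ℂ) * f j y) := by
    intro j
    rw [show gaussMoment j / (j.factorial : ℂ) * (r : ℂ) ^ j * f j y
      = gaussMoment j * ((r : ℂ) ^ j / (j.factorial : ℂ) * f j y) by ring, gaussMoment,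
      ← integral_mul_const]
    refine integral_congr_ae (Eventually.of_forall fun w => ?_)
    simp only
    push_cast
    ring
  rw [Finset.sum_congr rfl fun j _ => e1 j, ← integral_finsetSum _ fun j _ => i1 j,
    ← integral_sub i0 (integrable_finsetSum _ fun j _ => i1 j)]
  have e2 : S * gaussAbsMoment n * r ^ n = ∫ w : ℝ, (gauss w * |w| ^ n) * (S * r ^ n) := by
    rw [integral_mul_const, gaussAbsMoment]
    ring
  rw [e2]
  refine norm_integral_le_of_norm_le ((integrable_gauss_mul_abs_pow n).mul_const _)
    (Eventually.of_forall fun w => ?_)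
  rw [← Finset.mul_sum, ← mul_sub, norm_mul, Complex.norm_real,
    Real.norm_of_nonneg (gauss_nonneg w)]
  refine (mul_le_mul_of_nonneg_left (norm_taylor_remainder_le hf hS y (r * w))
    (gauss_nonneg w)).trans (le_of_eq ?_)
  rw [abs_mul, abs_of_pos hr, mul_pow]
  ring

/-- Compare with `∫₀¹ y^(-Re b) dy`. The bound is explicit so that the remainder constants are
continuous in `b`. -/
theorem IsCutoff.integral_norm_le {Ξ : ℝ → ℝ} (h : IsCutoff Ξ) {b : ℂ} (hb : b.re < 1) :
    ∫ y in Ioi (0 : ℝ), ‖cut Ξ y * (y : ℂ) ^ (-b)‖ ≤ 1 / (1 - b.re) := by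
  have hc := h.isTruncated.mono (R' := 1) le_rfl (by norm_num)
  have h1 : ∫ y in Ioi (0 : ℝ), (Iic (1 : ℝ)).indicator (fun x : ℝ => x ^ (-b.re)) y
      = 1 / (1 - b.re) := by
    rw [integral_indicator measurableSet_Iic, Measure.restrict_restrict measurableSet_Iic,
      Iic_inter_Ioi, ← intervalIntegral.integral_of_le zero_le_one,
      integral_rpow (Or.inl (by linarith))]
    rw [Real.zero_rpow (by linarith), Real.one_rpow]
    ring_nf
  rw [← h1]
  refine integral_mono_ae (hc.integrable hb).norm (integrable_indicator_rpow hb 1) ?_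
  filter_upwards [ae_restrict_mem measurableSet_Ioi] with y hy
  simpa using hc.norm_mul_cpow_le b hy

theorem gaussAbsMoment_nonneg (n : ℕ) : 0 ≤ gaussAbsMoment n :=
  integral_nonneg fun w => mul_nonneg (gauss_nonneg w) (by positivity)

/-- Expansion of `scaledVariation` for small dilation parameters. -/
theorem IsCutoff.exists_variation_expansion {Ξ : ℝ → ℝ} (h : IsCutoff Ξ) :
    ∃ G : ℕ → ℂ × ℂ → ℂ, (∀ j, Differentiable ℂ (G j)) ∧ (∀ j, Odd j → ∀ z, G j z = 0) ∧
      ∀ n : ℕ, ∃ K : ℂ × ℂ → ℝ, ContinuousOn K {z | z.1.re < 1 ∧ z.2.re < 1} ∧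
        ∀ a b : ℂ, a.re < 1 → b.re < 1 → ∀ r : ℝ, 0 < r →
          ‖scaledVariation Ξ a b r - (r : ℂ) ^ (a + b - 1) *
            ∑ j ∈ Finset.range n, G j (a, b) * (r : ℂ) ^ j‖
              ≤ K (a, b) * r ^ ((n : ℝ) + (a + b).re - 1) := by
  have hamp : IsAmplitude fun _ x => eulerCut Ξ x :=
    IsAmplitude.of _ h.contDiff_eulerCut fun x => h.eulerCut_eq_zero
  obtain ⟨P, hP0, hPA, hPd⟩ := hamp.exists_derivSeq
  -- Order `j` of the expansion: the Gaussian moment over `j!` times the `j`-th derivative of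
  -- `eulerCut Ξ x * x^(-a)`, tested against `Ξ x^(-b)`; the two powers merge into `x^(-(a+b))`.
  refine ⟨fun j z => gaussMoment j / (j.factorial : ℂ) *
    ∫ x in Ioi (0 : ℝ), P j z.1 x * cut Ξ x * (x : ℂ) ^ (-(z.1 + z.2)),
    fun j => ((hPA j).differentiable_integral h).const_mul _,
    fun j hj z => by simp [gaussMoment_odd hj], fun n => ?_⟩
  obtain ⟨S, hSc, hS⟩ := (hPA n).exists_bound_mul_cpow
  obtain ⟨S₀, -, hS₀⟩ := (hPA 0).exists_bound_mul_cpow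
  refine ⟨fun z => S z.1 * gaussAbsMoment n * (1 / (1 - z.2.re)), ?_, ?_⟩
  · refine ((hSc.comp continuous_fst).mul continuous_const).continuousOn.mul
      (continuousOn_const.div (by fun_prop) fun z hz => ?_)
    have := hz.2
    linarith
  intro a b ha hb r hr
  set f : ℕ → ℝ → ℂ := fun j x => P j a x * (x : ℂ) ^ (-a) with hf
  have hr0 : (r : ℂ) ≠ 0 := by exact_mod_cast hr.ne'
  have hcut := h.isTruncated
  obtain ⟨B, hB0, hB⟩ := isTruncated_of_support h.contDiff_eulerCut.continuous
    fun x => h.eulerCut_eq_zero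
  have hρ := hcut.integrable hb
  have e1 : scaledVariation Ξ a b r = (r : ℂ) ^ (a + b - 1) *
      ∫ y in Ioi (0 : ℝ), (∫ w : ℝ, (gauss w : ℂ) * f 0 (y + r * w)) *
        (cut Ξ y * (y : ℂ) ^ (-b)) := by
    rw [scaledVariation, pairing_comp_mul hB hcut ha hb hr]
    congr 1
    refine integral_congr_ae (Eventually.of_forall fun y => ?_)
    simp only
    rw [← integral_heatKernel_eq (fun x hx => ?_) hr, ← integral_mul_const]
    · simp only [hf, hP0]
    · simp only [hf]
      rw [(hPA 0).eq_zero a fun hx' => by linarith [hx'.1], zero_mul]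
  have iG : ∀ j, Integrable (fun y : ℝ => (gaussMoment j / (j.factorial : ℂ) * (r : ℂ) ^ j * f j y)
      * (cut Ξ y * (y : ℂ) ^ (-b))) (volume.restrict (Ioi 0)) := by
    intro j
    obtain ⟨Sj, -, hSj⟩ := (hPA j).exists_bound_mul_cpow
    have hc : Continuous (f j) := continuous_iff_continuousAt.2 fun x => (hPd j a x).continuousAt
    refine hρ.bdd_mul (c := ‖gaussMoment j / (j.factorial : ℂ) * (r : ℂ) ^ j‖ * Sj a)
      (continuous_const.mul hc).aestronglyMeasurable (Eventually.of_forall fun y => ?_)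
    rw [norm_mul]
    exact mul_le_mul_of_nonneg_left (hSj a y) (norm_nonneg _)
  have e2 : ∑ j ∈ Finset.range n, (gaussMoment j / (j.factorial : ℂ) *
      ∫ x in Ioi (0 : ℝ), P j a x * cut Ξ x * (x : ℂ) ^ (-(a + b))) * (r : ℂ) ^ j
      = ∫ y in Ioi (0 : ℝ), (∑ j ∈ Finset.range n,
        gaussMoment j / (j.factorial : ℂ) * (r : ℂ) ^ j * f j y) *
        (cut Ξ y * (y : ℂ) ^ (-b)) := by
    simp only [Finset.sum_mul]
    rw [integral_finsetSum _ fun j _ => iG j]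
    refine Finset.sum_congr rfl fun j _ => ?_
    rw [mul_right_comm, ← integral_const_mul]
    refine setIntegral_congr_fun measurableSet_Ioi fun y hy => ?_
    have hy0 : (y : ℂ) ≠ 0 := by exact_mod_cast (ne_of_gt hy)
    simp only [hf]
    rw [neg_add, Complex.cpow_add _ _ hy0]
    ring
  have hu : AEStronglyMeasurable (fun y : ℝ => ∫ w : ℝ, (gauss w : ℂ) * f 0 (y + r * w))
      (volume.restrict (Ioi 0)) := by
    have hc : Continuous (f 0) := continuous_iff_continuousAt.2 fun x => (hPd 0 a x).continuousAt
    have : Continuous fun q : ℝ × ℝ => (gauss q.2 : ℂ) * f 0 (q.1 + r * q.2) :=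
      (Complex.continuous_ofReal.comp (continuous_gauss.comp continuous_snd)).mul
        (hc.comp (by fun_prop))
    exact (this.aestronglyMeasurable (μ := (volume.restrict (Ioi 0)).prod volume)).integral_prod_right'
  have hbd : ∀ y, ‖∫ w : ℝ, (gauss w : ℂ) * f 0 (y + r * w)‖ ≤ ∫ w : ℝ, gauss w * |w| ^ 0 * S₀ a := by
    intro y
    refine norm_integral_le_of_norm_le ((integrable_gauss_mul_abs_pow 0).mul_const _)
      (Eventually.of_forall fun w => ?_)
    rw [norm_mul, Complex.norm_real, Real.norm_of_nonneg (gauss_nonneg w), pow_zero, mul_one]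
    exact mul_le_mul_of_nonneg_left (hS₀ a _) (gauss_nonneg w)
  have iu := hρ.bdd_mul hu (Eventually.of_forall hbd)
  have iS : Integrable (fun y : ℝ => (∑ j ∈ Finset.range n,
        gaussMoment j / (j.factorial : ℂ) * (r : ℂ) ^ j * f j y) *
        (cut Ξ y * (y : ℂ) ^ (-b))) (volume.restrict (Ioi 0)) := by
    simp only [Finset.sum_mul]
    exact integrable_finsetSum _ fun j _ => iG j
  have hS0 : 0 ≤ S a := (norm_nonneg _).trans (hS a 0)
  have hmain : ‖(∫ y in Ioi (0 : ℝ), (∫ w : ℝ, (gauss w : ℂ) * f 0 (y + r * w)) *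
        (cut Ξ y * (y : ℂ) ^ (-b))) - ∫ y in Ioi (0 : ℝ), (∑ j ∈ Finset.range n,
        gaussMoment j / (j.factorial : ℂ) * (r : ℂ) ^ j * f j y) *
        (cut Ξ y * (y : ℂ) ^ (-b))‖ ≤ (S a * gaussAbsMoment n * r ^ n) * (1 / (1 - b.re)) := by
    rw [← integral_sub iu iS]
    have hnn : 0 ≤ S a * gaussAbsMoment n * r ^ n :=
      mul_nonneg (mul_nonneg hS0 (gaussAbsMoment_nonneg n)) (by positivity)
    refine le_trans ?_ (mul_le_mul_of_nonneg_left (h.integral_norm_le hb) hnn)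
    rw [← integral_const_mul]
    refine norm_integral_le_of_norm_le (hρ.norm.const_mul _) (Eventually.of_forall fun y => ?_)
    rw [← sub_mul, norm_mul]
    exact mul_le_mul_of_nonneg_right (norm_gauss_average_sub_le (fun j x => hPd j a x)
      (fun x => hS a x) (fun x => hS₀ a x) hr y) (norm_nonneg _)
  simp only at hmain ⊢
  rw [e1, e2, ← mul_sub, norm_mul, Complex.norm_cpow_eq_rpow_re_of_pos hr]
  refine (mul_le_mul_of_nonneg_left hmain (by positivity)).trans (le_of_eq ?_)
  rw [show (n : ℝ) + (a + b).re - 1 = (a + b - 1).re + n by simp; ring, Real.rpow_add hr,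
    Real.rpow_natCast]
  ring

/-! ### Integration in the dilation parameter. -/

/-- A function on `(0, ∞)` whose derivative is `O(r^{e-1})` with `e > 0` has a limit at zero,
with an explicit rate. -/
theorem exists_limit_of_deriv_le {F F' : ℝ → ℂ} {K e : ℝ} (he : 0 < e)
    (hF : ∀ r, 0 < r → HasDerivAt F (F' r) r) (hF' : ∀ r, 0 < r → ‖F' r‖ ≤ K * r ^ (e - 1)) :
    ∃ L : ℂ, ∀ r, 0 < r → ‖F r - L‖ ≤ K / e * r ^ e := by
  have hK : 0 ≤ K := by
    have := (norm_nonneg _).trans (hF' 1 one_pos)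
    simpa using this
  -- Compare `F` with the explicit primitive of `K x^(e-1)`; this needs no integrability of `F'`.
  -- The estimate yields the Cauchy property at zero and, letting `r → 0`, the rate.
  have hmono : ∀ r r' : ℝ, 0 < r → r ≤ r' → ‖F r' - F r‖ ≤ K / e * r' ^ e := by
    intro r r' hr hrr'
    have hd : ∀ x, 0 < x → HasDerivAt (fun x : ℝ => K / e * (x ^ e - r ^ e)) (K * x ^ (e - 1)) x := by
      intro x hx
      refine HasDerivAt.congr_deriv
        (((Real.hasDerivAt_rpow_const (Or.inl hx.ne')).sub_const (r ^ e)).const_mul (K / e)) ?_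
      field_simp
    have := image_norm_le_of_norm_deriv_right_le_deriv_boundary'
      (f := fun x => F x - F r) (f' := F') (a := r) (b := r')
      (B := fun x => K / e * (x ^ e - r ^ e)) (B' := fun x => K * x ^ (e - 1))
      (fun x hx => ((hF x (hr.trans_le hx.1)).sub_const _).continuousAt.continuousWithinAt)
      (fun x hx => ((hF x (hr.trans_le hx.1)).sub_const _).hasDerivWithinAt)
      (by simp)
      (fun x hx => (hd x (hr.trans_le hx.1)).continuousAt.continuousWithinAt)
      (fun x hx => (hd x (hr.trans_le hx.1)).hasDerivWithinAt)
      (fun x hx => hF' x (hr.trans_le hx.1)) (right_mem_Icc.2 hrr')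
    refine this.trans (mul_le_mul_of_nonneg_left ?_ (by positivity))
    have : 0 ≤ r ^ e := by positivity
    linarith
  have hlim : Tendsto (fun r : ℝ => K / e * r ^ e) (𝓝[>] 0) (𝓝 0) := by
    have h := ((Real.continuousAt_rpow_const 0 e (Or.inr he.le)).tendsto.const_mul
      (K / e)).mono_left (nhdsWithin_le_nhds (s := Ioi (0 : ℝ)))
    simpa [Real.zero_rpow he.ne'] using h
  have hcauchy : Cauchy (map F (𝓝[>] 0)) := by
    rw [Metric.cauchy_iff]
    refine ⟨inferInstance, fun ε hε => ?_⟩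
    obtain ⟨δ, hδε, hδ⟩ := ((hlim.eventually (gt_mem_nhds (half_pos hε))).and
      self_mem_nhdsWithin).exists
    refine ⟨F '' Ioo 0 δ, image_mem_map (Ioo_mem_nhdsGT hδ), ?_⟩
    rintro _ ⟨x, hx, rfl⟩ _ ⟨y, hy, rfl⟩
    calc dist (F x) (F y) ≤ dist (F x) (F δ) + dist (F y) (F δ) := dist_triangle_right _ _ _
      _ < ε := by
        rw [dist_comm (F x), dist_comm (F y), dist_eq_norm, dist_eq_norm]
        have h1 := hmono x δ hx.1 hx.2.le
        have h2 := hmono y δ hy.1 hy.2.le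
        linarith
  obtain ⟨L, hL⟩ := cauchy_map_iff_exists_tendsto.1 hcauchy
  refine ⟨L, fun r hr => ?_⟩
  refine le_of_tendsto (hL.const_sub (F r)).norm ?_
  filter_upwards [Ioo_mem_nhdsGT hr] with x hx
  exact hmono x r hx.1 hx.2.le

theorem admissible_swap {a b : ℂ} (h : (a, b) ∈ admissible) : (b, a) ∈ admissible :=
  ⟨h.2.1, h.1, fun k => by rw [add_comm]; exact h.2.2 k⟩

/-- `scaledContent` has an expansion with coefficients `c`, constant term `L` and `n` explicit
terms, with a remainder controlled by `K`. -/
def HasContentExpansion (Ξ : ℝ → ℝ) (c : ℕ → ℂ × ℂ → ℂ) (n : ℕ) (L : ℂ × ℂ → ℂ)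
    (K : ℂ × ℂ → ℝ) : Prop :=
  ∀ a b : ℂ, (a, b) ∈ admissible → 0 < (n : ℝ) + (a + b).re - 1 → ∀ r : ℝ, 0 < r →
    ‖scaledContent Ξ a b r
      - ∑ j ∈ Finset.range n, c j (a, b) * (r : ℂ) ^ ((j : ℂ) + (a + b) - 1) - L (a, b)‖
      ≤ K (a, b) / ((n : ℝ) + (a + b).re - 1) * r ^ ((n : ℝ) + (a + b).re - 1)

/-- Expansion of `scaledContent` for small dilation parameters, up to the constant term. -/
theorem IsCutoff.exists_content_expansion {Ξ : ℝ → ℝ} (h : IsCutoff Ξ) :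
    ∃ c : ℕ → ℂ × ℂ → ℂ, (∀ j, DifferentiableOn ℂ (c j) admissible) ∧
      (∀ j a b, c j (a, b) = c j (b, a)) ∧
      ∀ n : ℕ, ∃ (L : ℂ × ℂ → ℂ) (K : ℂ × ℂ → ℝ),
        ContinuousOn K {z | z.1.re < 1 ∧ z.2.re < 1} ∧ HasContentExpansion Ξ c n L K := by
  obtain ⟨G, hGd, hGo, hG⟩ := h.exists_variation_expansion
  -- With `j = 2k` a zero denominator would mean `a + b = 1 - 2k`, which `admissible` excludes.
  have hden : ∀ j : ℕ, Even j → ∀ z ∈ admissible, (j : ℂ) + (z.1 + z.2) - 1 ≠ 0 := by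
    rintro j ⟨k, rfl⟩ z hz h0
    apply hz.2.2 k
    push_cast at h0
    linear_combination h0
  refine ⟨fun j z => (G j z + G j z.swap) / ((j : ℂ) + (z.1 + z.2) - 1), fun j => ?_, ?_, ?_⟩
  · rcases Nat.even_or_odd j with hj | hj
    · have hs : Differentiable ℂ fun z : ℂ × ℂ => G j z.swap :=
        (hGd j).comp (by unfold Prod.swap; fun_prop)
      have hd : Differentiable ℂ fun z : ℂ × ℂ => (j : ℂ) + (z.1 + z.2) - 1 := by fun_prop
      simp only [div_eq_mul_inv]
      exact ((hGd j).add hs).differentiableOn.mul (hd.differentiableOn.inv (hden j hj))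
    · simp only [hGo j hj, add_zero, zero_div]
      exact differentiableOn_const _
  · intro j a b
    simp only [Prod.swap]
    rw [add_comm (G j (a, b)), add_comm a b]
  intro n
  obtain ⟨K, hKc, hK⟩ := hG n
  -- The side conditions sit under the existential so that `L` can be chosen as a total function of
  -- `z`; elsewhere its value is arbitrary.
  have hex : ∀ z : ℂ × ℂ, ∃ L : ℂ, z ∈ admissible → 0 < (n : ℝ) + (z.1 + z.2).re - 1 →
      ∀ r : ℝ, 0 < r → ‖scaledContent Ξ z.1 z.2 r
        - ∑ j ∈ Finset.range n, (G j z + G j z.swap) / ((j : ℂ) + (z.1 + z.2) - 1) *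
          (r : ℂ) ^ ((j : ℂ) + (z.1 + z.2) - 1) - L‖
        ≤ (K z + K z.swap) / ((n : ℝ) + (z.1 + z.2).re - 1)
          * r ^ ((n : ℝ) + (z.1 + z.2).re - 1) := by
    rintro ⟨a, b⟩
    by_cases hz : (a, b) ∈ admissible ∧ 0 < (n : ℝ) + (a + b).re - 1
    swap
    · exact ⟨0, fun h1 h2 => absurd ⟨h1, h2⟩ hz⟩
    obtain ⟨hz, he⟩ := hz
    have ha : a.re < 1 := hz.1
    have hb : b.re < 1 := hz.2.1
    simp only [Prod.swap]
    refine (exists_limit_of_deriv_le he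
      (F := fun r => scaledContent Ξ a b r
        - ∑ j ∈ Finset.range n, (G j (a, b) + G j (b, a)) / ((j : ℂ) + (a + b) - 1) *
          (r : ℂ) ^ ((j : ℂ) + (a + b) - 1))
      (F' := fun r => (r : ℂ)⁻¹ * (scaledVariation Ξ a b r + scaledVariation Ξ b a r)
        - ∑ j ∈ Finset.range n, (G j (a, b) + G j (b, a)) / r *
          (r : ℂ) ^ ((j : ℂ) + (a + b) - 1))
      (K := K (a, b) + K (b, a)) (fun r hr => ?_) (fun r hr => ?_)).imp fun L hL _ _ => hL
    · refine (h.hasDerivAt_scaledContent ha hb hr).sub (HasDerivAt.fun_sum fun j _ => ?_)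
      have hd := (hasDerivAt_ofReal_cpow_neg (-((j : ℂ) + (a + b) - 1)) hr).const_mul
        ((G j (a, b) + G j (b, a)) / ((j : ℂ) + (a + b) - 1))
      simp only [neg_neg] at hd
      refine HasDerivAt.congr_deriv hd ?_
      rcases Nat.even_or_odd j with hj | hj
      · have := hden j hj (a, b) hz
        simp only at this
        field_simp
      -- For odd `j` the coefficient is `0`, so a possibly vanishing denominator is harmless.
      · simp [hGo j hj]
    · have hr0 : (r : ℂ) ≠ 0 := by exact_mod_cast hr.ne'
      have k1 := hK a b ha hb r hr
      have k2 := hK b a hb ha r hr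
      rw [add_comm b a] at k2
      have e1 : (r : ℂ)⁻¹ * (scaledVariation Ξ a b r + scaledVariation Ξ b a r)
          - ∑ j ∈ Finset.range n, (G j (a, b) + G j (b, a)) / r *
            (r : ℂ) ^ ((j : ℂ) + (a + b) - 1)
          = (r : ℂ)⁻¹ * ((scaledVariation Ξ a b r - (r : ℂ) ^ (a + b - 1) *
              ∑ j ∈ Finset.range n, G j (a, b) * (r : ℂ) ^ j)
            + (scaledVariation Ξ b a r - (r : ℂ) ^ (a + b - 1) *
              ∑ j ∈ Finset.range n, G j (b, a) * (r : ℂ) ^ j)) := by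
        have e2 : ∑ j ∈ Finset.range n, (G j (a, b) + G j (b, a)) / r *
            (r : ℂ) ^ ((j : ℂ) + (a + b) - 1) = (r : ℂ)⁻¹ * ((r : ℂ) ^ (a + b - 1) *
              ∑ j ∈ Finset.range n, G j (a, b) * (r : ℂ) ^ j + (r : ℂ) ^ (a + b - 1) *
              ∑ j ∈ Finset.range n, G j (b, a) * (r : ℂ) ^ j) := by
          rw [← mul_add, ← Finset.sum_add_distrib, ← mul_assoc, Finset.mul_sum]
          refine Finset.sum_congr rfl fun j _ => ?_
          rw [show (j : ℂ) + (a + b) - 1 = (a + b - 1) + j by ring, Complex.cpow_add _ _ hr0,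
            Complex.cpow_natCast]
          ring
        rw [e2]
        ring
      rw [e1, norm_mul, norm_inv, Complex.norm_real, Real.norm_of_nonneg hr.le,
        Real.rpow_sub_one hr.ne', ← mul_div_assoc, div_eq_inv_mul]
      refine mul_le_mul_of_nonneg_left ((norm_add_le _ _).trans ?_) (by positivity)
      rw [add_mul]
      exact add_le_add k1 k2
  choose L hL using hex
  refine ⟨L, fun z => K z + K z.swap, hKc.add (hKc.comp continuous_swap.continuousOn
    fun z hz => ⟨hz.2, hz.1⟩), fun a b hab he r hr => hL (a, b) hab he r hr⟩

/-! ### The limit of the pairing when `Re (a + b) > 1`. -/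

theorem integral_gauss_mul_cpow {s : ℂ} (hs : s.re < 2) :
    ∫ y in Ioi (0 : ℝ), (gauss y : ℂ) * (y : ℂ) ^ (1 - s)
      = (2 : ℂ) ^ (-s) * (1 / (Real.sqrt Real.pi : ℂ)) * Complex.Gamma ((2 - s) / 2) := by
  -- The substitution `t = y^2` reduces the Gaussian integral to the Gamma integral at `(2 - s)/2`.
  have h1 := mellin_comp_rpow (fun t : ℝ => Complex.exp (-((1 / 4 : ℝ) : ℂ) * t)) (2 - s) 2
  have hz : 0 < ((2 - s) / 2).re := by
    rw [show (2 - s) / 2 = ((1 / 2 : ℝ) : ℂ) * (2 - s) by push_cast; ring, Complex.re_ofReal_mul]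
    simp
    linarith
  have h2 := Complex.integral_cpow_mul_exp_neg_mul_Ioi (r := 1 / 4) hz (by norm_num)
  have h3 : mellin (fun t : ℝ => Complex.exp (-((1 / 4 : ℝ) : ℂ) * t)) ((2 - s) / 2)
      = (2 : ℂ) ^ (2 - s) * Complex.Gamma ((2 - s) / 2) := by
    rw [mellin]
    simp only [smul_eq_mul]
    simp only [neg_mul]
    rw [h2]
    congr 1
    rw [show (1 / ((1 / 4 : ℝ) : ℂ)) = ((2 : ℕ) : ℂ) ^ 2 by push_cast; norm_num,
      ← Complex.natCast_cpow_natCast_mul]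
    congr 1
    push_cast
    ring
  have hsq : Real.sqrt (4 * Real.pi) = 2 * Real.sqrt Real.pi := by
    rw [Real.sqrt_mul (by norm_num), show (4 : ℝ) = 2 ^ 2 by norm_num, Real.sqrt_sq (by norm_num)]
  have e : ∫ y in Ioi (0 : ℝ), (gauss y : ℂ) * (y : ℂ) ^ (1 - s)
      = (1 / (2 * (Real.sqrt Real.pi : ℂ))) *
        mellin (fun t : ℝ => Complex.exp (-((1 / 4 : ℝ) : ℂ) * ((t ^ (2 : ℝ) : ℝ) : ℂ)))
          (2 - s) := by
    rw [mellin, ← integral_const_mul]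
    refine setIntegral_congr_fun measurableSet_Ioi fun y hy => ?_
    simp only [gauss, smul_eq_mul]
    rw [hsq, show 2 - s - 1 = 1 - s by ring]
    push_cast
    rw [show (-(y : ℂ) ^ 2 / 4) = -(1 / 4) * ((y ^ (2 : ℝ) : ℝ) : ℂ) by
      rw [Real.rpow_two]; push_cast; ring]
    ring
  rw [Complex.ofReal_ofNat] at h1
  rw [e, h1, h3, show (2 : ℂ) - s = 2 + -s by ring, Complex.cpow_add _ _ two_ne_zero]
  rw [abs_of_pos two_pos, Complex.real_smul]
  push_cast
  rw [Complex.cpow_ofNat]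
  ring

theorem integral_gauss_dilate {t : ℝ} (ht : 0 < t) (c : ℂ) :
    ∫ y in Ioi (0 : ℝ), (gauss (t * y) : ℂ) * (y : ℂ) ^ (-c)
      = (t : ℂ) ^ (c - 1) * ∫ y in Ioi (0 : ℝ), (gauss y : ℂ) * (y : ℂ) ^ (-c) := by
  have ht0 : (t : ℂ) ≠ 0 := by exact_mod_cast ht.ne'
  have h := integral_comp_mul_left_Ioi (fun y : ℝ => (gauss y : ℂ) * (y : ℂ) ^ (-c)) 0 ht
  rw [mul_zero, Complex.real_smul] at h
  rw [Complex.cpow_sub _ _ ht0, Complex.cpow_one, div_eq_mul_inv, mul_assoc, ← Complex.ofReal_inv,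
    ← h, ← integral_const_mul]
  refine setIntegral_congr_fun measurableSet_Ioi fun y hy => ?_
  rw [cpow_eq_mul_cpow ht hy c]
  ring

theorem integral_gauss_dilate_real {t : ℝ} (ht : 0 < t) (c : ℝ) :
    ∫ y in Ioi (0 : ℝ), gauss (t * y) * y ^ (-c)
      = t ^ (c - 1) * ∫ y in Ioi (0 : ℝ), gauss y * y ^ (-c) := by
  have h := integral_comp_mul_left_Ioi (fun y : ℝ => gauss y * y ^ (-c)) 0 ht
  rw [mul_zero, smul_eq_mul] at h
  rw [Real.rpow_sub_one ht.ne', div_eq_mul_inv, mul_assoc, ← h, ← integral_const_mul]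
  refine setIntegral_congr_fun measurableSet_Ioi fun y hy => ?_
  rw [Real.mul_rpow ht.le (le_of_lt hy), mul_left_comm, ← mul_assoc (t ^ c), ← Real.rpow_add ht]
  simp

theorem integrable_gauss_dilate {t : ℝ} (ht : 0 < t) {c : ℝ} (hc : c < 1) :
    Integrable (fun y : ℝ => gauss (t * y) * y ^ (-c)) (volume.restrict (Ioi 0)) := by
  have h := ((integrable_rpow_mul_exp_neg_mul_sq (b := t ^ 2 / 4) (by positivity) (s := -c)
    (by linarith)).const_mul (1 / Real.sqrt (4 * Real.pi))).restrict (s := Ioi 0)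
  refine h.congr (Eventually.of_forall fun y => ?_)
  simp only [gauss]
  rw [show -(t * y) ^ 2 / 4 = -(t ^ 2 / 4) * y ^ 2 by ring]
  ring

/-- Lebesgue measure on `(0, 1) × (0, ∞)`. -/
abbrev strip : Measure (ℝ × ℝ) :=
  (volume.restrict (Ioo (0 : ℝ) 1)).prod (volume.restrict (Ioi (0 : ℝ)))

/-- The homogeneous integrand in the coordinates `(v, y) = (x / y, y)`. -/
def stripIntegrand (a b : ℂ) (q : ℝ × ℝ) : ℂ :=
  (gauss ((1 - q.1) * q.2) : ℂ) * ((q.1 : ℂ) ^ (-a) * (q.2 : ℂ) ^ (-(a + b - 1)))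

theorem norm_stripIntegrand (a b : ℂ) {v y : ℝ} (h1 : 0 < v) (h2 : 0 < y) :
    ‖stripIntegrand a b (v, y)‖
      = v ^ (-a.re) * (gauss ((1 - v) * y) * y ^ (-((a + b).re - 1))) := by
  rw [stripIntegrand, norm_mul, norm_mul, Complex.norm_cpow_eq_rpow_re_of_pos h1,
    Complex.norm_cpow_eq_rpow_re_of_pos h2, Complex.norm_real,
    Real.norm_of_nonneg (gauss_nonneg _)]
  simp only [Complex.neg_re, Complex.sub_re, Complex.one_re]
  ring

/-- Integrate the norm in `y` first, which converges at zero because `Re (a + b) < 2`. Scaling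
leaves `v^(-Re a) (1-v)^(Re (a+b) - 2)`, a convergent Beta integrand because `Re a < 1` and `Re (a +
b) > 1`. -/
theorem integrable_stripIntegrand {a b : ℂ} (ha : a.re < 1) (hb : b.re < 1)
    (hs : 1 < (a + b).re) : Integrable (stripIntegrand a b) strip := by
  have hs2 : (a + b).re - 1 < 1 := by rw [Complex.add_re]; linarith
  have hm : AEStronglyMeasurable (stripIntegrand a b) strip := by
    have h1 : AEStronglyMeasurable (fun q : ℝ × ℝ => (gauss ((1 - q.1) * q.2) : ℂ)) strip := by
      have : Continuous (fun q : ℝ × ℝ => (gauss ((1 - q.1) * q.2) : ℂ)) :=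
        Complex.continuous_ofReal.comp (continuous_gauss.comp (by fun_prop))
      exact this.aestronglyMeasurable
    have h2 : AEStronglyMeasurable (fun x : ℝ => (x : ℂ) ^ (-a)) (volume.restrict (Ioo 0 1)) :=
      (aestronglyMeasurable_cpow (-a)).mono_measure
        (Measure.restrict_mono Ioo_subset_Ioi_self le_rfl)
    exact h1.mul (h2.comp_fst.mul (aestronglyMeasurable_cpow (-(a + b - 1))).comp_snd)
  rw [strip, integrable_prod_iff hm]
  constructor
  · filter_upwards [ae_restrict_mem measurableSet_Ioo,
      hm.prodMk_left] with v hv hmv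
    refine ((integrable_gauss_dilate (sub_pos.2 hv.2) hs2).const_mul (v ^ (-a.re))).mono' hmv ?_
    filter_upwards [ae_restrict_mem measurableSet_Ioi] with y hy
    exact (norm_stripIntegrand a b hv.1 hy).le
  · have hbeta := (intervalIntegrable_iff_integrableOn_Ioo_of_le zero_le_one).1
      (Complex.betaIntegral_convergent (u := 1 - a) (v := a + b - 1) (by simpa using ha)
        (by rw [Complex.sub_re, Complex.one_re]; linarith))
    refine ((hbeta.norm.const_mul
      (∫ y in Ioi (0 : ℝ), gauss y * y ^ (-((a + b).re - 1)))).congr ?_)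
    filter_upwards [ae_restrict_mem measurableSet_Ioo] with v hv
    have h1v : 0 < 1 - v := sub_pos.2 hv.2
    rw [setIntegral_congr_fun measurableSet_Ioi fun y hy => norm_stripIntegrand a b hv.1 hy]
    rw [integral_const_mul, integral_gauss_dilate_real h1v, norm_mul,
      Complex.norm_cpow_eq_rpow_re_of_pos hv.1, ← Complex.ofReal_one, ← Complex.ofReal_sub,
      Complex.norm_cpow_eq_rpow_re_of_pos h1v]
    simp only [Complex.ofReal_one, Complex.sub_re, Complex.one_re]
    rw [show 1 - a.re - 1 = -a.re by ring]
    ring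

/-- Scaling in `y` separates the variables: the `v`-integral is the Beta value `B(1-a, a+b-1) =
Γ(1-a) Γ(a+b-1) / Γ(b)`, and the `y`-integral is the Gaussian one above. -/
theorem integral_stripIntegrand {a b : ℂ} (ha : a.re < 1) (hb : b.re < 1)
    (hs : 1 < (a + b).re) : ∫ q, stripIntegrand a b q ∂strip
      = (2 : ℂ) ^ (-a - b) * (1 / (Real.sqrt Real.pi : ℂ)) * Complex.Gamma ((2 - a - b) / 2)
        * Complex.Gamma (a + b - 1) * (Complex.Gamma (1 - a) / Complex.Gamma b) := by
  rw [integral_prod _ (integrable_stripIntegrand ha hb hs)]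
  have e : ∀ v ∈ Ioo (0 : ℝ) 1, ∫ y in Ioi (0 : ℝ), stripIntegrand a b (v, y)
      = ((v : ℂ) ^ (1 - a - 1) * (1 - (v : ℂ)) ^ (a + b - 1 - 1)) *
        ∫ y in Ioi (0 : ℝ), (gauss y : ℂ) * (y : ℂ) ^ (1 - (a + b)) := by
    intro v hv
    have h1v : 0 < 1 - v := sub_pos.2 hv.2
    have h := integral_gauss_dilate h1v (a + b - 1)
    rw [show -(a + b - 1) = 1 - (a + b) by ring] at h
    rw [← Complex.ofReal_one, ← Complex.ofReal_sub, Complex.ofReal_one, mul_assoc, ← h,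
      ← integral_const_mul]
    refine integral_congr_ae (Eventually.of_forall fun y => ?_)
    simp only [stripIntegrand]
    rw [show 1 - a - 1 = -a by ring, show -(a + b - 1) = 1 - (a + b) by ring]
    ring
  rw [setIntegral_congr_fun measurableSet_Ioo e, integral_mul_const,
    integral_gauss_mul_cpow (by rw [Complex.add_re]; linarith), ← integral_Ioc_eq_integral_Ioo,
    ← intervalIntegral.integral_of_le zero_le_one]
  change Complex.betaIntegral (1 - a) (a + b - 1) * _ = _
  have hB := Complex.Gamma_mul_Gamma_eq_betaIntegral (s := 1 - a) (t := a + b - 1)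
    (by simpa using ha) (by rw [Complex.sub_re, Complex.one_re]; linarith)
  rw [show 1 - a + (a + b - 1) = b by ring] at hB
  have hGb : Complex.Gamma b ≠ 0 := Complex.Gamma_ne_zero_of_re_pos (by
    rw [Complex.add_re] at hs; linarith)
  rw [show -a - b = -(a + b) by ring, show 2 - a - b = 2 - (a + b) by ring]
  field_simp
  linear_combination (-Complex.Gamma ((2 - (a + b)) / 2)) * hB

/-- The integrand of `pairing f f` in the coordinates `(v, y) = (x / y, y)`. -/
def stripCut (f : ℝ → ℂ) (a b : ℂ) (q : ℝ × ℝ) : ℂ :=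
  stripIntegrand a b q * (f (q.2 * q.1) * f q.2)

theorem norm_stripCut_le {f : ℝ → ℂ} {C R : ℝ} (hf : IsTruncated f C R) (a b : ℂ) (q : ℝ × ℝ) :
    ‖stripCut f a b q‖ ≤ ‖stripIntegrand a b q‖ * (C * C) := by
  rw [stripCut, norm_mul, norm_mul]
  exact mul_le_mul_of_nonneg_left (mul_le_mul (hf.2.1 _) (hf.2.1 _) (norm_nonneg _)
    ((norm_nonneg _).trans (hf.2.1 0))) (norm_nonneg _)

theorem aestronglyMeasurable_stripCut {f : ℝ → ℂ} {C R : ℝ} (hf : IsTruncated f C R) {a b : ℂ}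
    (ha : a.re < 1) (hb : b.re < 1) (hs : 1 < (a + b).re) :
    AEStronglyMeasurable (stripCut f a b) strip :=
  (integrable_stripIntegrand ha hb hs).aestronglyMeasurable.mul
    ((hf.1.comp (by fun_prop)).mul (hf.1.comp (by fun_prop))).aestronglyMeasurable

theorem integral_stripCut {f : ℝ → ℂ} {C R : ℝ} (hf : IsTruncated f C R) {a b : ℂ}
    (ha : a.re < 1) (hb : b.re < 1) (hs : 1 < (a + b).re) :
    ∫ q, stripCut f a b q ∂strip
      = ∫ y in Ioi (0 : ℝ), ∫ x in Ioo 0 y, integrand f f a b (x, y) := by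
  have hi : Integrable (stripCut f a b) strip :=
    ((integrable_stripIntegrand ha hb hs).norm.mul_const (C * C)).mono'
      (aestronglyMeasurable_stripCut hf ha hb hs)
      (Eventually.of_forall fun q => norm_stripCut_le hf a b q)
  rw [integral_prod_symm _ hi]
  refine setIntegral_congr_fun measurableSet_Ioi fun y hy => ?_
  have hy0 : (y : ℂ) ≠ 0 := by exact_mod_cast (ne_of_gt hy)
  have h := intervalIntegral.smul_integral_comp_mul_left (a := 0) (b := 1)
    (fun x => integrand f f a b (x, y)) y
  rw [mul_zero, mul_one, Complex.real_smul, intervalIntegral.integral_of_le zero_le_one,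
    intervalIntegral.integral_of_le (le_of_lt hy), integral_Ioc_eq_integral_Ioo,
    integral_Ioc_eq_integral_Ioo, ← integral_const_mul] at h
  rw [← h]
  refine setIntegral_congr_fun measurableSet_Ioo fun v hv => ?_
  simp only [stripCut, stripIntegrand, integrand]
  rw [gauss_sub_comm, show y - y * v = (1 - v) * y by ring, Complex.ofReal_mul y v,
    Complex.mul_cpow_ofReal_nonneg (le_of_lt hy) hv.1.le,
    show -(a + b - 1) = 1 + -a + -b by ring, Complex.cpow_add _ _ hy0, Complex.cpow_add _ _ hy0,
    Complex.cpow_one]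
  ring

/-- Split the quadrant along the diagonal. The part `x ≥ y` becomes the part `x ≤ y` with the
exponents exchanged, and the diagonal is null. -/
theorem pairing_eq_add_strip {f : ℝ → ℂ} {C R : ℝ} (hf : IsTruncated f C R) {a b : ℂ}
    (ha : a.re < 1) (hb : b.re < 1) (hs : 1 < (a + b).re) :
    pairing f f a b = ∫ q, stripCut f a b q ∂strip + ∫ q, stripCut f b a q ∂strip := by
  have hi := integrable_integrand hf hf ha hb
  have hi' := integrable_integrand hf hf hb ha
  have hS : MeasurableSet {p : ℝ × ℝ | p.1 < p.2} := measurableSet_lt measurable_fst measurable_snd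
  have hS' : MeasurableSet {p : ℝ × ℝ | p.1 ≤ p.2} := measurableSet_le measurable_fst measurable_snd
  rw [integral_stripCut hf ha hb hs, integral_stripCut hf hb ha (by rwa [add_comm]), pairing,
    ← integral_add_compl hS hi, ← integral_indicator hS, ← integral_indicator hS.compl]
  congr 1
  · rw [integral_prod_symm _ (hi.indicator hS)]
    refine integral_congr_ae (Eventually.of_forall fun y => ?_)
    have : ∀ x, {p : ℝ × ℝ | p.1 < p.2}.indicator (integrand f f a b) (x, y)
        = (Iio y).indicator (fun x => integrand f f a b (x, y)) x := by
      intro x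
      simp [indicator]
    simp only [this]
    rw [setIntegral_indicator measurableSet_Iio, Ioi_inter_Iio]
  · rw [← integral_prod_swap]
    have e : ∀ p : ℝ × ℝ, {p : ℝ × ℝ | p.1 < p.2}ᶜ.indicator (integrand f f a b) p.swap
        = {p : ℝ × ℝ | p.1 ≤ p.2}.indicator (integrand f f b a) p := by
      intro p
      simp [indicator, integrand_swap]
    simp only [e]
    rw [integral_prod_symm _ (hi'.indicator hS')]
    refine integral_congr_ae (Eventually.of_forall fun y => ?_)
    have : ∀ x, {p : ℝ × ℝ | p.1 ≤ p.2}.indicator (integrand f f b a) (x, y)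
        = (Iic y).indicator (fun x => integrand f f b a (x, y)) x := by
      intro x
      simp [indicator]
    simp only [this]
    rw [setIntegral_indicator measurableSet_Iic, Ioi_inter_Iic, integral_Ioc_eq_integral_Ioo]

/-- Dominated convergence: the cut-offs are bounded by `1` and tend pointwise to `Ξ(0) = 1`. -/
theorem IsCutoff.tendsto_stripCut {Ξ : ℝ → ℝ} (h : IsCutoff Ξ) {a b : ℂ}
    (ha : a.re < 1) (hb : b.re < 1) (hs : 1 < (a + b).re) :
    Tendsto (fun r : ℝ => ∫ q, stripCut (fun x => cut Ξ (r * x)) a b q ∂strip) (𝓝[>] 0)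
      (𝓝 (∫ q, stripIntegrand a b q ∂strip)) := by
  have hcut := h.isTruncated
  have hcont : Continuous (cut Ξ) := Complex.continuous_ofReal.comp h.smooth.continuous
  have h0 : cut Ξ 0 = 1 := by simp [cut, h.eq_one 0 (by norm_num)]
  have hpt : ∀ z : ℝ, Tendsto (fun r : ℝ => cut Ξ (r * z)) (𝓝[>] 0) (𝓝 1) := by
    intro z
    have : Continuous fun r : ℝ => cut Ξ (r * z) := hcont.comp (by fun_prop)
    have h1 := (this.tendsto 0).mono_left (nhdsWithin_le_nhds (s := Ioi (0 : ℝ)))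
    simpa [h0] using h1
  refine tendsto_integral_filter_of_dominated_convergence
    (fun q => ‖stripIntegrand a b q‖ * (1 * 1)) ?_ ?_
    ((integrable_stripIntegrand ha hb hs).norm.mul_const _) ?_
  · filter_upwards [self_mem_nhdsWithin] with r hr
    exact aestronglyMeasurable_stripCut (hcut.comp_mul hr) ha hb hs
  · filter_upwards [self_mem_nhdsWithin] with r hr
    exact Eventually.of_forall fun q => norm_stripCut_le (hcut.comp_mul hr) a b q
  · refine Eventually.of_forall fun q => ?_
    have := ((hpt (q.2 * q.1)).mul (hpt q.2)).const_mul (stripIntegrand a b q)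
    simpa [stripCut] using this

theorem mem_regularSet_of_re {a b : ℂ} (hs : 1 < (a + b).re) : (a, b) ∈ regularSet := by
  intro k hk
  simp only at hk
  rw [hk] at hs
  simp at hs
  have := k.cast_nonneg (α := ℝ)
  linarith

theorem mem_admissible_of_re {a b : ℂ} (ha : a.re < 1) (hb : b.re < 1) (hs : 1 < (a + b).re) :
    (a, b) ∈ admissible := by
  refine ⟨ha, hb, fun k hk => ?_⟩
  simp only at hk
  rw [hk] at hs
  simp at hs
  have := k.cast_nonneg (α := ℝ)
  linarith

theorem IsCutoff.tendsto_scaledContent {Ξ : ℝ → ℝ} (h : IsCutoff Ξ) {a b : ℂ}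
    (ha : a.re < 1) (hb : b.re < 1) (hs : 1 < (a + b).re) :
    Tendsto (scaledContent Ξ a b) (𝓝[>] 0) (𝓝 (boundaryClosed (a, b))) := by
  have hs' : 1 < (b + a).re := by rwa [add_comm]
  rw [← boundaryFormula_eq_closed (mem_admissible_of_re ha hb hs) (mem_regularSet_of_re hs)]
  have e : boundaryFormula (a, b)
      = ∫ q, stripIntegrand a b q ∂strip + ∫ q, stripIntegrand b a q ∂strip := by
    rw [integral_stripIntegrand ha hb hs, integral_stripIntegrand hb ha hs', boundaryFormula,
      add_comm b a, show -b - a = -a - b by ring, show 2 - b - a = 2 - a - b by ring]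
    ring
  rw [e]
  refine ((h.tendsto_stripCut ha hb hs).add (h.tendsto_stripCut hb ha hs')).congr' ?_
  filter_upwards [self_mem_nhdsWithin] with r hr
  exact (pairing_eq_add_strip (h.isTruncated.comp_mul hr) ha hb hs).symm

theorem boundaryClosed_swap (a b : ℂ) : boundaryClosed (a, b) = boundaryClosed (b, a) := by
  simp only [boundaryClosed]
  rw [show (Real.pi : ℂ) * (a - b) / 2 = -(Real.pi * (b - a) / 2) by ring, Complex.cos_neg,
    add_comm a b]
  ring

/-! ### Analytic continuation of the constant term. -/

/-- Identity theorem on a vertical strip from which points of a horizontal line are removed. -/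
theorem eqOn_of_eqOn_right {U : Set ℂ} {F G : ℂ → ℂ} {α γ κ : ℝ} (hU : IsOpen U)
    (hα : ∀ z ∈ U, α < z.re ∧ z.re < 1)
    (hoff : ∀ z : ℂ, α < z.re → z.re < 1 → z.im ≠ κ → z ∈ U)
    (hF : DifferentiableOn ℂ F U) (hG : DifferentiableOn ℂ G U) (hγ : γ < 1)
    (hFG : ∀ z ∈ U, γ < z.re → F z = G z) : EqOn F G U := by
  have hoffEq : ∀ z ∈ U, z.im ≠ κ → F z = G z := by
    intro z hz hκ
    obtain ⟨hz1, hz2⟩ := hα z hz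
    -- The part of the strip on the same side of the line as `z`: it is convex, avoids the removed
    -- points, and contains `w₀`, near which the two functions agree.
    set H : Set ℂ := {w | α < w.re} ∩ {w | w.re < 1} ∩ {w | 0 < (z.im - κ) * (w.im - κ)} with hH
    have hHU : H ⊆ U := by
      rintro w ⟨⟨h1, h2⟩, h3⟩
      refine hoff w h1 h2 fun h => ?_
      rw [mem_ofPred_eq, h] at h3
      simp at h3
    have hconv : Convex ℝ H := by
      refine ((convex_halfSpace_re_gt α).inter (convex_halfSpace_re_lt 1)).inter ?_
      have : {w : ℂ | 0 < (z.im - κ) * (w.im - κ)}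
          = {w : ℂ | (z.im - κ) * κ < ((z.im - κ) • Complex.imLm) w} := by
        ext w
        simp only [mem_ofPred_eq, LinearMap.smul_apply, smul_eq_mul, Complex.imLm_coe]
        constructor <;> intro h <;> nlinarith
      rw [this]
      exact convex_halfSpace_gt (LinearMap.isLinear _) _
    set w₀ : ℂ := ⟨(max α γ + 1) / 2, z.im⟩ with hw₀
    have hm : max α γ < 1 := max_lt (hz1.trans hz2) hγ
    have hsq : 0 < (z.im - κ) * (z.im - κ) := mul_self_pos.2 (sub_ne_zero.2 hκ)
    have hw₀H : w₀ ∈ H := by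
      refine ⟨⟨?_, ?_⟩, hsq⟩
      · have := le_max_left α γ
        simp only [mem_ofPred_eq, hw₀]
        linarith
      · simp only [mem_ofPred_eq, hw₀]
        linarith
    have hzH : z ∈ H := ⟨⟨hz1, hz2⟩, hsq⟩
    have hev : F =ᶠ[𝓝 w₀] G := by
      have h1 : γ < w₀.re := by
        have := le_max_right α γ
        simp only [hw₀]
        linarith
      filter_upwards [hU.mem_nhds (hHU hw₀H),
        (isOpen_lt continuous_const Complex.continuous_re).mem_nhds h1] with w hw hw'
      exact hFG w hw hw'
    exact ((hF.analyticOnNhd hU).mono hHU).eqOn_of_preconnected_of_eventuallyEq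
      ((hG.analyticOnNhd hU).mono hHU) hconv.isPreconnected hw₀H hev hzH
  intro z hz
  by_cases hκ : z.im = κ
  swap
  · exact hoffEq z hz hκ
  -- Points of `U` on the exceptional line are reached vertically by continuity.
  have hc : Tendsto (fun y : ℝ => z + (y : ℂ) * Complex.I) (𝓝[>] 0) (𝓝 z) := by
    have : Continuous fun y : ℝ => z + (y : ℂ) * Complex.I := by fun_prop
    have h := (this.tendsto 0).mono_left (nhdsWithin_le_nhds (s := Ioi (0 : ℝ)))
    simpa using h
  have hFz := ((hF.differentiableAt (hU.mem_nhds hz)).continuousAt.tendsto).comp hc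
  have hGz := ((hG.differentiableAt (hU.mem_nhds hz)).continuousAt.tendsto).comp hc
  refine tendsto_nhds_unique_of_eventuallyEq hFz hGz ?_
  filter_upwards [hc.eventually_mem (hU.mem_nhds hz), self_mem_nhdsWithin] with y hy hy0
  refine hoffEq _ hy ?_
  simp only [Complex.add_im, Complex.mul_im, Complex.ofReal_re, Complex.I_im, mul_one,
    Complex.ofReal_im, Complex.I_re, mul_zero, add_zero, hκ]
  intro h
  rw [mem_Ioi] at hy0
  linarith

section

variable {Ξ : ℝ → ℝ} {c : ℕ → ℂ × ℂ → ℂ} {n : ℕ} {L : ℂ × ℂ → ℂ} {K : ℂ × ℂ → ℝ}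

theorem HasContentExpansion.tendsto (h : HasContentExpansion Ξ c n L K) {a b : ℂ}
    (hab : (a, b) ∈ admissible) (he : 0 < (n : ℝ) + (a + b).re - 1) :
    Tendsto (fun r : ℝ => scaledContent Ξ a b r
      - ∑ j ∈ Finset.range n, c j (a, b) * (r : ℂ) ^ ((j : ℂ) + (a + b) - 1)) (𝓝[>] 0)
      (𝓝 (L (a, b))) := by
  rw [tendsto_iff_norm_sub_tendsto_zero]
  have hlim : Tendsto (fun r : ℝ => K (a, b) / ((n : ℝ) + (a + b).re - 1) *
      r ^ ((n : ℝ) + (a + b).re - 1)) (𝓝[>] 0) (𝓝 0) := by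
    have h := ((Real.continuousAt_rpow_const 0 _ (Or.inr he.le)).tendsto.const_mul
      (K (a, b) / ((n : ℝ) + (a + b).re - 1))).mono_left (nhdsWithin_le_nhds (s := Ioi (0 : ℝ)))
    rwa [Real.zero_rpow he.ne', mul_zero] at h
  refine squeeze_zero' (Eventually.of_forall fun r => norm_nonneg _) ?_ hlim
  filter_upwards [self_mem_nhdsWithin] with r hr
  exact h a b hab he r hr

/-- Here every exponent `j + a + b - 1` has positive real part, so the explicit terms tend to `0`
and the constant is the limit of `scaledContent`. -/
theorem HasContentExpansion.eq_of_re (h : HasContentExpansion Ξ c n L K) (hΞ : IsCutoff Ξ)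
    {a b : ℂ} (hab : (a, b) ∈ admissible) (hs : 1 < (a + b).re) :
    L (a, b) = boundaryClosed (a, b) := by
  have hn := n.cast_nonneg (α := ℝ)
  refine tendsto_nhds_unique (h.tendsto hab (by linarith)) ?_
  have h1 := hΞ.tendsto_scaledContent hab.1 hab.2.1 hs
  have h2 : Tendsto (fun r : ℝ => ∑ j ∈ Finset.range n,
      c j (a, b) * (r : ℂ) ^ ((j : ℂ) + (a + b) - 1)) (𝓝[>] 0)
      (𝓝 (∑ j ∈ Finset.range n, c j (a, b) * 0)) := by
    refine tendsto_finsetSum _ fun j _ => Tendsto.const_mul _ ?_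
    have hj := j.cast_nonneg (α := ℝ)
    have hre : 0 < ((j : ℂ) + (a + b) - 1).re := by
      rw [Complex.sub_re, Complex.add_re, Complex.natCast_re, Complex.one_re]
      linarith
    have := ((Complex.continuousAt_ofReal_cpow_const 0 _ (Or.inl hre)).tendsto).mono_left
      (nhdsWithin_le_nhds (s := Ioi (0 : ℝ)))
    rwa [Complex.ofReal_zero, Complex.zero_cpow (fun h0 => by simp [h0] at hre)] at this
  simpa using h1.sub h2

theorem HasContentExpansion.symm (h : HasContentExpansion Ξ c n L K)
    (hc : ∀ j a b, c j (a, b) = c j (b, a)) {a b : ℂ}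
    (hab : (a, b) ∈ admissible) (he : 0 < (n : ℝ) + (a + b).re - 1) : L (a, b) = L (b, a) := by
  refine tendsto_nhds_unique (h.tendsto hab he) ?_
  have := h.tendsto (admissible_swap hab) (by rwa [add_comm b a])
  simpa only [scaledContent_swap b a, hc _ b a, add_comm b a] using this

/-- The second exponents for which the constant term of the expansion is defined. -/
def fiber (n : ℕ) (a : ℂ) : Set ℂ := {b | (a, b) ∈ admissible ∧ 0 < (n : ℝ) + (a + b).re - 1}

theorem isOpen_fiber (n : ℕ) (a : ℂ) : IsOpen (fiber n a) := by
  refine (isOpen_admissible.preimage (by fun_prop : Continuous fun b : ℂ => (a, b))).inter ?_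
  have : Continuous fun b : ℂ => (n : ℝ) + (a + b).re - 1 := by fun_prop
  exact isOpen_lt continuous_const this

/-- In `b` the constant term is a locally uniform limit of holomorphic functions as `r → 0`;
continuity of `K` and of the exponent makes the remainder small uniformly near each point. -/
theorem HasContentExpansion.differentiableOn (h : HasContentExpansion Ξ c n L K)
    (hΞ : IsCutoff Ξ) (hcd : ∀ j, DifferentiableOn ℂ (c j) admissible)
    (hK : ContinuousOn K {z | z.1.re < 1 ∧ z.2.re < 1}) (a : ℂ) :
    DifferentiableOn ℂ (fun b => L (a, b)) (fiber n a) := by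
  have hpair : Differentiable ℂ fun b : ℂ => (a, b) := by fun_prop
  have hunif : TendstoLocallyUniformlyOn (fun (r : ℝ) (b : ℂ) => scaledContent Ξ a b r
      - ∑ j ∈ Finset.range n, c j (a, b) * (r : ℂ) ^ ((j : ℂ) + (a + b) - 1))
      (fun b => L (a, b)) (𝓝[>] 0) (fiber n a) := by
    rw [tendstoLocallyUniformlyOn_iff_forall_tendsto]
    intro b₀ hb₀
    rw [tendsto_uniformity_iff_dist_tendsto_zero]
    set e : ℂ → ℝ := fun b => (n : ℝ) + (a + b).re - 1 with hedef
    have hec : Continuous e := by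
      simp only [hedef]
      fun_prop
    have he0 : 0 < e b₀ := hb₀.2
    have hsnd : Tendsto (fun y : ℝ × ℂ => y.2) (𝓝[>] 0 ×ˢ 𝓝[fiber n a] b₀) (𝓝 b₀) :=
      tendsto_snd.mono_right nhdsWithin_le_nhds
    have hfst : Tendsto (fun y : ℝ × ℂ => y.1) (𝓝[>] 0 ×ˢ 𝓝[fiber n a] b₀) (𝓝 0) :=
      tendsto_fst.mono_right nhdsWithin_le_nhds
    have he : Tendsto (fun y : ℝ × ℂ => e y.2) (𝓝[>] 0 ×ˢ 𝓝[fiber n a] b₀) (𝓝 (e b₀)) :=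
      (hec.tendsto b₀).comp hsnd
    have hKt : Tendsto (fun y : ℝ × ℂ => K (a, y.2)) (𝓝[>] 0 ×ˢ 𝓝[fiber n a] b₀)
        (𝓝 (K (a, b₀))) := by
      have hopen : IsOpen {z : ℂ × ℂ | z.1.re < 1 ∧ z.2.re < 1} :=
        (isOpen_lt (Complex.continuous_re.comp continuous_fst) continuous_const).inter
          (isOpen_lt (Complex.continuous_re.comp continuous_snd) continuous_const)
      have hKa : ContinuousAt K (a, b₀) :=
        hK.continuousAt (hopen.mem_nhds ⟨hb₀.1.1, hb₀.1.2.1⟩)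
      exact hKa.tendsto.comp ((hpair.continuous.tendsto b₀).comp hsnd)
    have hlim : Tendsto (fun y : ℝ × ℂ => K (a, y.2) / e y.2 * y.1 ^ e y.2)
        (𝓝[>] 0 ×ˢ 𝓝[fiber n a] b₀) (𝓝 0) := by
      have := (hKt.div he he0.ne').mul (hfst.rpow he (Or.inr he0))
      rwa [Real.zero_rpow he0.ne', mul_zero] at this
    refine squeeze_zero' (Eventually.of_forall fun y => dist_nonneg) ?_ hlim
    have h1 : ∀ᶠ y : ℝ × ℂ in 𝓝[>] 0 ×ˢ 𝓝[fiber n a] b₀, y.1 ∈ Ioi (0 : ℝ) :=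
      tendsto_fst.eventually_mem self_mem_nhdsWithin
    have h2 : ∀ᶠ y : ℝ × ℂ in 𝓝[>] 0 ×ˢ 𝓝[fiber n a] b₀, y.2 ∈ fiber n a :=
      tendsto_snd.eventually_mem self_mem_nhdsWithin
    filter_upwards [h1, h2] with y hy1 hy2
    rw [dist_comm, dist_eq_norm]
    exact h a y.2 hy2.1 hy2.2 y.1 hy1
  refine hunif.differentiableOn ?_ (isOpen_fiber n a)
  filter_upwards [self_mem_nhdsWithin] with r hr
  have hr0 : (r : ℂ) ≠ 0 := by exact_mod_cast (ne_of_gt hr)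
  have hcut := hΞ.isTruncated.comp_mul hr
  intro b hb
  refine DifferentiableAt.differentiableWithinAt ?_
  refine (pairing_differentiableAt hcut hcut hb.1.1 hb.1.2.1).sub
    (DifferentiableAt.fun_sum fun j _ => DifferentiableAt.mul ?_ ?_)
  · exact ((hcd j).differentiableAt (isOpen_admissible.mem_nhds hb.1)).comp b (hpair b)
  · exact (by fun_prop : DifferentiableAt ℂ (fun b : ℂ => (j : ℂ) + (a + b) - 1) b).const_cpow
      (Or.inl hr0)

theorem HasContentExpansion.eq_of_right (h : HasContentExpansion Ξ c n L K)
    (hΞ : IsCutoff Ξ) (hcd : ∀ j, DifferentiableOn ℂ (c j) admissible)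
    (hK : ContinuousOn K {z | z.1.re < 1 ∧ z.2.re < 1}) {a : ℂ} (ha : a.re < 1) {γ : ℝ}
    (hγ : γ < 1)
    (hright : ∀ b ∈ fiber n a, γ < b.re → L (a, b) = boundaryClosed (a, b)) :
    ∀ b ∈ fiber n a, L (a, b) = boundaryClosed (a, b) := by
  have hpair : Differentiable ℂ fun b : ℂ => (a, b) := by fun_prop
  refine eqOn_of_eqOn_right (F := fun b => L (a, b)) (G := fun b => boundaryClosed (a, b))
    -- The removed points `b = 1 - 2k - a` all have imaginary part `-Im a`.
    (α := 1 - n - a.re) (κ := -a.im) (isOpen_fiber n a) ?_ ?_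
    (h.differentiableOn hΞ hcd hK a) ?_ hγ hright
  · intro b hb
    have := hb.2
    rw [Complex.add_re] at this
    exact ⟨by linarith, hb.1.2.1⟩
  · intro b hb1 hb2 him
    refine ⟨⟨ha, hb2, fun k hk => him ?_⟩, by rw [Complex.add_re]; linarith⟩
    have := congrArg Complex.im hk
    simp at this
    linarith
  · intro b hb
    exact ((differentiableAt_boundaryClosed hb.1).comp b (hpair b)).differentiableWithinAt

/-- If `Re a > 0`, some `b` with `Re b < 1` satisfy `Re (a + b) > 1`, so the explicit limit seeds a
continuation in `b`. By symmetry equality also holds when `Re b > 0`, which seeds the continuation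
for arbitrary `a`. -/
theorem HasContentExpansion.eq_closed (h : HasContentExpansion Ξ c n L K)
    (hΞ : IsCutoff Ξ) (hcd : ∀ j, DifferentiableOn ℂ (c j) admissible)
    (hc : ∀ j a b, c j (a, b) = c j (b, a))
    (hK : ContinuousOn K {z | z.1.re < 1 ∧ z.2.re < 1}) {a b : ℂ}
    (hab : (a, b) ∈ admissible) (he : 0 < (n : ℝ) + (a + b).re - 1) :
    L (a, b) = boundaryClosed (a, b) := by
  have hpos : ∀ a : ℂ, 0 < a.re → a.re < 1 → ∀ b ∈ fiber n a,
      L (a, b) = boundaryClosed (a, b) := by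
    intro a ha0 ha1
    refine h.eq_of_right hΞ hcd hK ha1 (γ := 1 - a.re) (by linarith) fun b hb hb' => ?_
    exact h.eq_of_re hΞ hb.1 (by rw [Complex.add_re]; linarith)
  refine h.eq_of_right hΞ hcd hK hab.1 (γ := 0) one_pos (fun b hb hb' => ?_) b ⟨hab, he⟩
  rw [h.symm hc hb.1 hb.2, boundaryClosed_swap]
  exact hpos b hb' hb.1.2.1 a ⟨admissible_swap hb.1, by rw [add_comm b a]; exact hb.2⟩

end

/-! ### Return to the heat content of the unit interval. -/

theorem IsCutoff.setIntegral_Icc {Ξ : ℝ → ℝ} (h : IsCutoff Ξ) {f : ℝ → ℂ}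
    (hf : ∀ x, cut Ξ x = 0 → f x = 0) : ∫ x in Icc (0 : ℝ) 1, f x = ∫ x in Ioi (0 : ℝ), f x := by
  rw [integral_Icc_eq_integral_Ioc]
  refine (setIntegral_eq_of_subset_of_forall_sdiff_eq_zero measurableSet_Ioi Ioc_subset_Ioi_self
    fun x hx => hf x ?_).symm
  have : 1 < x := by
    by_contra hx'
    exact hx.2 ⟨hx.1, not_lt.1 hx'⟩
  simp [cut, h.eq_zero x (by linarith)]

theorem IsCutoff.heatContent_eq {Ξ : ℝ → ℝ} (h : IsCutoff Ξ) {a b : ℂ} (ha : a.re < 1)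
    (hb : b.re < 1) {r : ℝ} (hr : 0 < r) :
    heatContent (Icc 0 1) (cutoffPower Ξ a) (cutoffPower Ξ b) (r ^ 2)
      = (r : ℂ) ^ (1 - a - b) * scaledContent Ξ a b r := by
  have hr0 : (r : ℂ) ≠ 0 := by exact_mod_cast hr.ne'
  rw [scaledContent, pairing_comp_mul h.isTruncated h.isTruncated ha hb hr, ← mul_assoc,
    ← Complex.cpow_add _ _ hr0, show 1 - a - b + (a + b - 1) = 0 by ring, Complex.cpow_zero,
    one_mul, heatContent, h.setIntegral_Icc]
  · refine integral_congr_ae (Eventually.of_forall fun y => ?_)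
    exact h.setIntegral_Icc fun x hx => by
      rw [cut] at hx
      simp [cutoffPower, hx]
  · intro y hy
    rw [cut] at hy
    simp [cutoffPower, hy]

theorem sq_cpow_half {r : ℝ} (hr : 0 < r) (z : ℂ) : ((r ^ 2 : ℝ) : ℂ) ^ (z / 2) = (r : ℂ) ^ z := by
  have hr0 : (r : ℂ) ≠ 0 := by exact_mod_cast hr.ne'
  rw [pow_two, Complex.ofReal_mul, Complex.mul_cpow_ofReal_nonneg hr.le hr.le,
    ← Complex.cpow_add _ _ hr0]
  congr 1
  ring

end HeatContent

end

theorem corollary3p11 (Ξ : ℝ → ℝ) (hΞ : HeatContent.IsCutoff Ξ) :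
    DifferentiableOn ℂ HeatContent.boundaryCoeff HeatContent.admissible ∧
    Set.EqOn HeatContent.boundaryCoeff HeatContent.boundaryFormula
      (HeatContent.admissible ∩ HeatContent.regularSet) ∧
    ∃ c : ℕ → ℂ × ℂ → ℂ,
      (∀ n : ℕ, DifferentiableOn ℂ (c n) HeatContent.admissible) ∧
      ∀ a b : ℂ, (a, b) ∈ HeatContent.admissible →
        ∀ N : ℕ, (-a - b).re + 3 < (N : ℝ) →
          (fun t : ℝ =>
            HeatContent.heatContent (Set.Icc 0 1)
                (HeatContent.cutoffPower Ξ a) (HeatContent.cutoffPower Ξ b) t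
              - (∑ n ∈ Finset.range (N + 1), c n (a, b) * (t : ℂ) ^ ((n : ℂ) / 2)
                  + HeatContent.boundaryCoeff (a, b) * (t : ℂ) ^ ((1 - a - b) / 2)))
            =O[𝓝[>] (0 : ℝ)] (fun t : ℝ => t ^ (((N : ℝ) + 1) / 2)) := by
  refine ⟨HeatContent.differentiableOn_boundaryCoeff, HeatContent.boundaryCoeff_eqOn, ?_⟩
  obtain ⟨c, hcd, hcs, hexp⟩ := hΞ.exists_content_expansion
  refine ⟨c, hcd, fun a b hab N hN => ?_⟩
  -- Taking `N + 1` terms means orders `0` to `N`. After multiplication by `r^(1-a-b)` the remainder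
  -- is of size `r^(N+1) = t^((N+1)/2)`.
  obtain ⟨L, K, hK, hLK⟩ := hexp (N + 1)
  have he : 0 < ((N + 1 : ℕ) : ℝ) + (a + b).re - 1 := by
    have e : (-a - b).re = -(a + b).re := by simp; ring
    rw [e] at hN
    push_cast
    linarith
  have hL : L (a, b) = HeatContent.boundaryCoeff (a, b) :=
    (HeatContent.HasContentExpansion.eq_closed hLK hΞ hcd hcs hK hab he).trans
      (HeatContent.boundaryCoeff_eq_closed hab).symm
  refine Asymptotics.IsBigO.of_bound (K (a, b) / (((N + 1 : ℕ) : ℝ) + (a + b).re - 1)) ?_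
  filter_upwards [self_mem_nhdsWithin] with t ht
  obtain ⟨r, hr, rfl⟩ : ∃ r : ℝ, 0 < r ∧ r ^ 2 = t :=
    ⟨Real.sqrt t, Real.sqrt_pos.2 ht, Real.sq_sqrt (le_of_lt ht)⟩
  have hr0 : (r : ℂ) ≠ 0 := by exact_mod_cast hr.ne'
  have key := hLK a b hab he r hr
  have e1 : HeatContent.heatContent (Set.Icc 0 1)
      (HeatContent.cutoffPower Ξ a) (HeatContent.cutoffPower Ξ b) (r ^ 2)
      - (∑ n ∈ Finset.range (N + 1), c n (a, b) * ((r ^ 2 : ℝ) : ℂ) ^ ((n : ℂ) / 2)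
        + HeatContent.boundaryCoeff (a, b) * ((r ^ 2 : ℝ) : ℂ) ^ ((1 - a - b) / 2))
      = (r : ℂ) ^ (1 - a - b) * (HeatContent.scaledContent Ξ a b r
        - ∑ j ∈ Finset.range (N + 1), c j (a, b) * (r : ℂ) ^ ((j : ℂ) + (a + b) - 1)
        - L (a, b)) := by
    have e2 : ∑ n ∈ Finset.range (N + 1), c n (a, b) * ((r ^ 2 : ℝ) : ℂ) ^ ((n : ℂ) / 2)
        = (r : ℂ) ^ (1 - a - b) *
          ∑ j ∈ Finset.range (N + 1), c j (a, b) * (r : ℂ) ^ ((j : ℂ) + (a + b) - 1) := by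
      rw [Finset.mul_sum]
      refine Finset.sum_congr rfl fun j _ => ?_
      rw [HeatContent.sq_cpow_half hr, mul_left_comm, ← Complex.cpow_add _ _ hr0]
      congr 2
      ring
    rw [hΞ.heatContent_eq hab.1 hab.2.1 hr, e2, HeatContent.sq_cpow_half hr, hL]
    ring
  have e3 : ‖(r ^ 2) ^ (((N : ℝ) + 1) / 2)‖ = r ^ ((N : ℝ) + 1) := by
    rw [Real.norm_of_nonneg (by positivity), ← Real.rpow_two, ← Real.rpow_mul hr.le]
    congr 1
    ring
  rw [e1, e3, norm_mul, Complex.norm_cpow_eq_rpow_re_of_pos hr]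
  refine (mul_le_mul_of_nonneg_left key (by positivity)).trans (le_of_eq ?_)
  rw [mul_left_comm, ← Real.rpow_add hr]
  congr 2
  simp
  ring
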